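/- For an integer $b\ge 2$, let $\mathcal{N}_b\subset[0,1)\subset\mathbb{R}$ be the set of base-$b$ normal numbers, that is, of those $x\in[0,1)$ such that for every finite word $u$ of base-$b$ digits, of length $|u|$, the number $N_u(x,n)$ of occurrences of $u$ as a block of consecutive digits among the first $n$ base-$b$ digits of $x$ satisfies $\lim_{n\to\infty} N_u(x,n)/n=b^{-|u|}$. In a topological space $X$, let $\boldsymbol{\Sigma}^0_1$ and $\boldsymbol{\Pi}^0_1$ be the classes of open and of closed sets; for $n\ge 2$, let $\boldsymbol{\Sigma}^0_n$ (respectively $\boldsymbol{\Pi}^0_n$) be the class of countable unions (respectively intersections) of sets from the classes $\boldsymbol{\Pi}^0_m$ (respectively $\boldsymbol{\Sigma}^0_m$) with $1\le m<n$. Let $D_2(\boldsymbol{\Pi}^0_3)=\{A\setminus B: A,B\in\boldsymbol{\Pi}^0_3\}$. A set $A\subset\mathbb{R}$ is called $D_2(\boldsymbol{\Pi}^0_3)$-hard if for every zero-dimensional Polish space $X$ and every $B\subset X$ in the class $D_2(\boldsymbol{\Pi}^0_3)$ of $X$ there is a continuous $f:X\to\mathbb{R}$ with $B=f^{-1}(A)$,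 and $D_2(\boldsymbol{\Pi}^0_3)$-complete if it is $D_2(\boldsymbol{\Pi}^0_3)$-hard and belongs to the class $D_2(\boldsymbol{\Pi}^0_3)$ of $\mathbb{R}$. Theorem. If $b,c\ge 2$ are relatively prime integers, then the set $\mathcal{N}_b\setminus\mathcal{N}_c$ of numbers that are base-$b$ normal but not base-$c$ normal is $D_2(\boldsymbol{\Pi}^0_3)$-complete. -/

import Mathlib

open Set Filter Topology

universe u

/-- `IsSigma0 n s`: the set `s` belongs to the (boldface) Borel class `Σ⁰ₙ` of the topological
space `X`, for a finite level `n ≥ 1`. The class `Σ⁰₁` consists of the open sets, and for `n > 1`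
the members of `Σ⁰ₙ` are the countable unions of sets from the classes `Π⁰ₘ`, `1 ≤ m < n`, where
a set is `Π⁰ₘ` when its complement is `Σ⁰ₘ`. (There is no set of level `0`.) -/
inductive IsSigma0 {X : Type*} [TopologicalSpace X] : ℕ → Set X → Prop
  | of_isOpen {s : Set X} (hs : IsOpen s) : IsSigma0 1 s
  | iUnion {n : ℕ} (m : ℕ → ℕ) (A : ℕ → Set X) (hm : ∀ k, m k < n)
      (hA : ∀ k, IsSigma0 (m k) (A k)ᶜ) : IsSigma0 n (⋃ k, A k)

/-- The Borel class `Π⁰ₙ`, for a finite level `n ≥ 1`: complements of `Σ⁰ₙ` sets. Equivalently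
(by De Morgan), `Π⁰₁` consists of the closed sets and, for `n > 1`, the members of `Π⁰ₙ` are the
countable intersections of sets from the classes `Σ⁰ₘ`, `1 ≤ m < n`. -/
def IsPi0 {X : Type*} [TopologicalSpace X] (n : ℕ) (s : Set X) : Prop :=
  IsSigma0 n sᶜ

/-- The difference class `D₂(Π⁰ₙ)`: the sets `A \ B` with `A` and `B` in `Π⁰ₙ`. -/
def IsD2Pi0 {X : Type*} [TopologicalSpace X] (n : ℕ) (s : Set X) : Prop :=
  ∃ A B : Set X, IsPi0 n A ∧ IsPi0 n B ∧ s = A \ B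

/-- `A ⊆ ℝ` is `D₂(Π⁰ₙ)`-hard: every `D₂(Π⁰ₙ)` subset of a zero-dimensional Polish space is the
preimage of `A` under a continuous map. -/
def IsD2Pi0Hard (n : ℕ) (A : Set ℝ) : Prop :=
  ∀ (X : Type u) [TopologicalSpace X] [PolishSpace X] [HasSmallInductiveDimensionLE X 0]
    (B : Set X), IsD2Pi0 n B → ∃ f : X → ℝ, Continuous f ∧ B = f ⁻¹' A

/-- `A ⊆ ℝ` is `D₂(Π⁰ₙ)`-complete: it belongs to `D₂(Π⁰ₙ)` and is `D₂(Π⁰ₙ)`-hard. -/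
def IsD2Pi0Complete (n : ℕ) (A : Set ℝ) : Prop :=
  IsD2Pi0 n A ∧ IsD2Pi0Hard.{u} n A

/-- `wordCount x u n`: the number of times the word `u = u₀ ⋯ uₖ₋₁` of base-`b` digits appears as
a block of consecutive digits among the first `n` base-`b` digits of `x ∈ [0, 1)`. The possible
starting positions are numbered from `0`. -/
noncomputable def wordCount {b : ℕ} [NeZero b] (x : ℝ) {k : ℕ} (u : Fin k → Fin b) (n : ℕ) : ℕ :=
  {i ∈ Finset.range n | i + k ≤ n ∧ ∀ j : Fin k, Real.digits x b (i + j) = u j}.card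

/-- The set of base-`b` normal numbers in `[0, 1)`: every finite word of base-`b` digits, of
length `k`, appears in the base-`b` expansion with limiting frequency `b⁻ᵏ`, which is the Lebesgue
measure of the set of numbers whose expansion begins with that word. -/
def normalNumbers (b : ℕ) [NeZero b] : Set ℝ :=
  {x | x ∈ Ico (0 : ℝ) 1 ∧ ∀ (k : ℕ) (u : Fin k → Fin b),
    Tendsto (fun n : ℕ => (wordCount x u n : ℝ) / n) atTop (𝓝 (1 / (b : ℝ) ^ k))}

/-!
Membership in the class `D₂(Π⁰₃)` is Weyl's criterion: `x ∈ [0, 1)` is normal to base `b` if and only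
if the exponential sums `∑_{j < n} e(k bʲ x)`, `k ≥ 1`, are `o(n)`. They are continuous in `x`, and
therefore `normalNumbers b` is `Π⁰₃` (`isPi0_normalNumbers`). The sums for all frequencies are
combined with weights `2⁻ᵏ` into one quantity `weylSum b n x`, and only this quantity is estimated in
the rest of the proof.

For hardness, a `Π⁰₃` subset of a zero-dimensional Polish space is a continuous preimage of the set of
sequences of natural numbers tending to infinity (`IsPi0.exists_continuous_tendsto_atTop`). It is
therefore enough to find a real number `y`, depending continuously on two sequences `z` and `w`, which
is normal to base `b` if and only if `z → ∞` and normal to base `c` if and only if `w → ∞`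
(`exists_continuous_mem_normalNumbers_iff`).

The number `y` is the common point of nested intervals. At each stage one of the two bases, say `c`,
is given a run of zero digits from position `p` to position `p + p / m`, where `m` is the current term
of the sequence that controls this base. If `m` stays bounded along infinitely many stages then the
frequency of the digit zero oscillates and `y` is not normal to base `c`; if `m → ∞` then the runs are
negligible. The point is that a run in base `c` must not disturb base `b` (`exists_step`). At the
beginning of the run `y` is close to a fraction `a / c ^ p`. The base-`b` orbit of this fraction is
well distributed up to time `n₁ = log_b (c ^ p)` if it shadows that of a typical real number. After
time `n₁` it is the orbit of `(b ^ n₁ * a mod c ^ p) / c ^ p`. As `b` and `c` are coprime,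
`a ↦ b ^ n₁ * a` permutes the residues modulo `c ^ p`; hence for most `a` the second fraction, too, is
close to a typical real number, and both requirements can be met at once by counting
(`exists_cell`). "Typical" refers to Lebesgue measure: by orthogonality of the characters and a second
moment estimate, almost every number has small exponential sums (`ae_tendsto_weylSum`).
-/

/-! ### Exponential sums along geometric progressions -/

/-- The character `x ↦ exp (2πix)` of the circle `ℝ / ℤ`, as a function on `ℝ`. -/
noncomputable def circleExp (x : ℝ) : ℂ := Complex.exp ((2 * Real.pi * x : ℝ) * Complex.I)

lemma norm_circleExp (x : ℝ) : ‖circleExp x‖ = 1 := Complex.norm_exp_ofReal_mul_I _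

lemma circleExp_add (x y : ℝ) : circleExp (x + y) = circleExp x * circleExp y := by
  rw [circleExp, circleExp, circleExp, ← Complex.exp_add]
  congr 1; push_cast; ring

lemma circleExp_intCast (t : ℤ) : circleExp t = 1 := by
  rw [circleExp, Complex.exp_eq_one_iff]
  exact ⟨t, by push_cast; ring⟩

lemma circleExp_add_intCast (x : ℝ) (t : ℤ) : circleExp (x + t) = circleExp x := by
  rw [circleExp_add, circleExp_intCast, mul_one]

lemma continuous_circleExp : Continuous circleExp := by
  unfold circleExp; fun_prop

lemma norm_circleExp_sub_le (x y : ℝ) :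
    ‖circleExp x - circleExp y‖ ≤ 2 * Real.pi * |x - y| := by
  have h : circleExp x - circleExp y = circleExp y * (circleExp (x - y) - 1) := by
    rw [mul_sub, ← circleExp_add, mul_one]; congr 2; ring
  rw [h, norm_mul, norm_circleExp, one_mul, circleExp, mul_comm _ Complex.I]
  refine (Real.norm_exp_I_mul_ofReal_sub_one_le).trans ?_
  rw [Real.norm_eq_abs, abs_mul, abs_of_pos Real.two_pi_pos]

/-- The exponential sum `∑_{j < n} e(k bʲ x)`. -/
noncomputable def expSum (b k n : ℕ) (x : ℝ) : ℂ :=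
  ∑ j ∈ Finset.range n, circleExp (k * b ^ j * x)

lemma norm_expSum_le (b k n : ℕ) (x : ℝ) : ‖expSum b k n x‖ ≤ n := by
  refine (norm_sum_le _ _).trans ?_
  simp [norm_circleExp]

lemma continuous_expSum (b k n : ℕ) : Continuous (expSum b k n) := by
  unfold expSum
  exact continuous_finsetSum _ fun j _ => continuous_circleExp.comp (by fun_prop)

lemma expSum_add (b k m n : ℕ) (x : ℝ) :
    expSum b k (m + n) x = expSum b k m x + expSum b k n (b ^ m * x) := by
  simp only [expSum, Finset.sum_range_add]
  congr 1
  refine Finset.sum_congr rfl fun j _ => ?_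
  congr 1; rw [pow_add]; ring

lemma expSum_add_intCast (b k n : ℕ) (x : ℝ) (t : ℤ) :
    expSum b k n (x + t) = expSum b k n x := by
  refine Finset.sum_congr rfl fun j _ => ?_
  have : (k * b ^ j * (x + t) : ℝ) = k * b ^ j * x + ((k * b ^ j * t : ℤ) : ℝ) := by
    push_cast; ring
  rw [this, circleExp_add_intCast]

lemma sum_range_pow_le {b : ℕ} (hb : 2 ≤ b) (n : ℕ) :
    ∑ j ∈ Finset.range n, (b : ℝ) ^ j ≤ b ^ n := by
  have h := Nat.geomSum_lt (s := Finset.range n) hb fun k hk => Finset.mem_range.mp hk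
  exact_mod_cast h.le

lemma norm_expSum_sub_le {b : ℕ} (hb : 2 ≤ b) (k n : ℕ) (x y : ℝ) :
    ‖expSum b k n x - expSum b k n y‖ ≤ 2 * Real.pi * k * (b ^ n * |x - y|) := by
  rw [expSum, expSum, ← Finset.sum_sub_distrib]
  refine (norm_sum_le _ _).trans ?_
  calc ∑ j ∈ Finset.range n, ‖circleExp (k * b ^ j * x) - circleExp (k * b ^ j * y)‖
      ≤ ∑ j ∈ Finset.range n, 2 * Real.pi * k * |x - y| * (b : ℝ) ^ j := by
        refine Finset.sum_le_sum fun j _ => (norm_circleExp_sub_le _ _).trans (le_of_eq ?_)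
        rw [← mul_sub, abs_mul, abs_of_nonneg (by positivity)]; ring
    _ ≤ 2 * Real.pi * k * |x - y| * (b : ℝ) ^ n := by
        rw [← Finset.mul_sum]
        exact mul_le_mul_of_nonneg_left (sum_range_pow_le hb n) (by positivity)
    _ = _ := by ring

/-- A weighted combination of the moduli of the exponential sums of all positive frequencies
`k + 1`. By Weyl's criterion `x` is normal to base `b` exactly when `weylSum b n x = o(n)`, so that
this single quantity replaces the countably many conditions in the definition of normality. -/
noncomputable def weylSum (b n : ℕ) (x : ℝ) : ℝ :=
  ∑' k : ℕ, (1 / 2) ^ (k + 1) * ‖expSum b (k + 1) n x‖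

lemma hasSum_half_pow_succ : HasSum (fun k : ℕ => (1 / 2 : ℝ) ^ (k + 1)) 1 := by
  have := (hasSum_geometric_two).mul_left (1 / 2 : ℝ)
  simpa [pow_succ'] using this

lemma hasSum_succ_mul_half_pow_succ :
    HasSum (fun k : ℕ => ((k + 1 : ℕ) : ℝ) * (1 / 2 : ℝ) ^ (k + 1)) 2 := by
  have h := hasSum_coe_mul_geometric_of_norm_lt_one (𝕜 := ℝ) (r := 1 / 2) (by norm_num)
  norm_num at h
  have h2 := (hasSum_nat_add_iff' 1).mpr h
  simpa using h2

lemma weylSum_term_le (b n : ℕ) (x : ℝ) (k : ℕ) :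
    (1 / 2 : ℝ) ^ (k + 1) * ‖expSum b (k + 1) n x‖ ≤ n * (1 / 2 : ℝ) ^ (k + 1) := by
  rw [mul_comm (n : ℝ)]
  exact mul_le_mul_of_nonneg_left (norm_expSum_le _ _ _ _) (by positivity)

lemma summable_weylSum (b n : ℕ) (x : ℝ) :
    Summable fun k : ℕ => (1 / 2 : ℝ) ^ (k + 1) * ‖expSum b (k + 1) n x‖ :=
  Summable.of_nonneg_of_le (fun _ => by positivity) (weylSum_term_le b n x)
    (hasSum_half_pow_succ.summable.mul_left _)

lemma weylSum_nonneg (b n : ℕ) (x : ℝ) : 0 ≤ weylSum b n x :=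
  tsum_nonneg fun _ => by positivity

lemma weylSum_le (b n : ℕ) (x : ℝ) : weylSum b n x ≤ n := by
  have h := (summable_weylSum b n x).tsum_le_tsum (weylSum_term_le b n x)
    (hasSum_half_pow_succ.summable.mul_left _)
  rwa [(hasSum_half_pow_succ.mul_left (n : ℝ)).tsum_eq, mul_one] at h

lemma weylSum_add_le (b m n : ℕ) (x : ℝ) :
    weylSum b (m + n) x ≤ weylSum b m x + weylSum b n (b ^ m * x) := by
  rw [weylSum, weylSum, weylSum, ← (summable_weylSum b m x).tsum_add (summable_weylSum b n _)]
  refine (summable_weylSum b _ x).tsum_le_tsum (fun k => ?_)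
    ((summable_weylSum b m x).add (summable_weylSum b n _))
  rw [← mul_add, expSum_add]
  exact mul_le_mul_of_nonneg_left (norm_add_le _ _) (by positivity)

lemma weylSum_add_intCast (b n : ℕ) (x : ℝ) (t : ℤ) : weylSum b n (x + t) = weylSum b n x := by
  simp only [weylSum, expSum_add_intCast]

/-- Nearby points have comparable sums for as long as their orbits stay within distance `C`. -/
lemma weylSum_le_add {b : ℕ} (hb : 2 ≤ b) {n : ℕ} {x y C : ℝ} (h : b ^ n * |x - y| ≤ C) :
    weylSum b n x ≤ weylSum b n y + 13 * C := by
  have hs := hasSum_succ_mul_half_pow_succ.mul_right (2 * Real.pi * C)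
  have h1 : weylSum b n x ≤ weylSum b n y + 2 * (2 * Real.pi * C) := by
    rw [← hs.tsum_eq, weylSum, weylSum, ← (summable_weylSum b n y).tsum_add hs.summable]
    refine (summable_weylSum b n x).tsum_le_tsum (fun k => ?_)
      ((summable_weylSum b n y).add hs.summable)
    have h2 : ‖expSum b (k + 1) n x‖ ≤
        ‖expSum b (k + 1) n y‖ + 2 * Real.pi * (k + 1 : ℕ) * C := by
      have h3 := norm_expSum_sub_le hb (k + 1) n x y
      have h4 := norm_sub_norm_le (expSum b (k + 1) n x) (expSum b (k + 1) n y)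
      have h5 : 2 * Real.pi * (k + 1 : ℕ) * (b ^ n * |x - y|) ≤ 2 * Real.pi * (k + 1 : ℕ) * C :=
        mul_le_mul_of_nonneg_left h (by positivity)
      linarith
    calc _ ≤ (1 / 2 : ℝ) ^ (k + 1) * (‖expSum b (k + 1) n y‖ + 2 * Real.pi * (k + 1 : ℕ) * C) :=
          mul_le_mul_of_nonneg_left h2 (by positivity)
      _ = _ := by ring
  have hC : 0 ≤ C := le_trans (by positivity) h
  nlinarith [Real.pi_lt_d2]

lemma continuous_weylSum (b n : ℕ) : Continuous (weylSum b n) := by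
  refine continuous_tsum (u := fun k => n * (1 / 2 : ℝ) ^ (k + 1))
    (fun k => continuous_const.mul (continuous_expSum _ _ _).norm)
    (hasSum_half_pow_succ.summable.mul_left _) fun k x => ?_
  rw [Real.norm_of_nonneg (by positivity)]
  exact weylSum_term_le b n x k

lemma norm_expSum_le_weylSum (b k n : ℕ) (x : ℝ) :
    ‖expSum b (k + 1) n x‖ ≤ 2 ^ (k + 1) * weylSum b n x := by
  have h := (summable_weylSum b n x).le_tsum k fun _ _ => by positivity
  calc ‖expSum b (k + 1) n x‖
      = 2 ^ (k + 1) * ((1 / 2 : ℝ) ^ (k + 1) * ‖expSum b (k + 1) n x‖) := by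
        rw [← mul_assoc, ← mul_pow]; norm_num
    _ ≤ _ := mul_le_mul_of_nonneg_left h (by positivity)

lemma tendsto_weylSum_div {b : ℕ} {x : ℝ}
    (h : ∀ k : ℕ, Tendsto (fun n : ℕ => ‖expSum b (k + 1) n x‖ / n) atTop (𝓝 0)) :
    Tendsto (fun n : ℕ => weylSum b n x / n) atTop (𝓝 0) := by
  have h1 : Tendsto (fun n : ℕ => ∑' k : ℕ, (1 / 2 : ℝ) ^ (k + 1) * (‖expSum b (k + 1) n x‖ / n))
      atTop (𝓝 (∑' k : ℕ, (1 / 2 : ℝ) ^ (k + 1) * 0)) := by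
    refine tendsto_tsum_of_dominated_convergence hasSum_half_pow_succ.summable
      (fun k => (h k).const_mul _) (Eventually.of_forall fun n k => ?_)
    rw [Real.norm_of_nonneg (by positivity)]
    refine mul_le_of_le_one_right (by positivity) ?_
    exact div_le_one_of_le₀ (norm_expSum_le _ _ _ _) (by positivity)
  simp only [mul_zero, tsum_zero] at h1
  refine h1.congr fun n => ?_
  rw [weylSum, ← tsum_div_const]
  exact tsum_congr fun k => by ring

/-! ### Almost every number has small exponential sums -/

lemma integral_circleExp_intCast_mul (t : ℤ) :
    ∫ x in (0 : ℝ)..1, circleExp (t * x) = if t = 0 then 1 else 0 := by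
  split_ifs with ht
  · simp [ht, circleExp]
  · have hc : (2 * Real.pi * t * Complex.I : ℂ) ≠ 0 := by
      simp [ht, Real.pi_ne_zero]
    have h : ∀ x : ℝ, circleExp (t * x) = Complex.exp ((2 * Real.pi * t * Complex.I : ℂ) * x) := by
      intro x; rw [circleExp]; congr 1; push_cast; ring
    simp only [h, integral_exp_mul_complex hc]
    have h1 : Complex.exp (2 * Real.pi * t * Complex.I * (1 : ℝ)) = 1 := by
      rw [Complex.exp_eq_one_iff]; exact ⟨t, by push_cast; ring⟩
    rw [h1]; simp

lemma circleExp_neg (x : ℝ) : circleExp (-x) = (starRingEnd ℂ) (circleExp x) := by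
  rw [circleExp, circleExp, ← Complex.exp_conj]
  congr 1
  rw [map_mul, Complex.conj_ofReal, Complex.conj_I]
  push_cast; ring

lemma integral_norm_expSum_sq {b k : ℕ} (hb : 2 ≤ b) (hk : k ≠ 0) (n : ℕ) :
    ∫ x in (0 : ℝ)..1, ‖expSum b k n x‖ ^ 2 = n := by
  have hcont : ∀ i j : ℕ, Continuous fun x : ℝ => circleExp (((k * b ^ i - k * b ^ j : ℤ) : ℝ) * x) :=
    fun i j => continuous_circleExp.comp (by fun_prop)
  have h : ∀ x : ℝ, ((‖expSum b k n x‖ ^ 2 : ℝ) : ℂ) = ∑ i ∈ Finset.range n, ∑ j ∈ Finset.range n,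
      circleExp (((k * b ^ i - k * b ^ j : ℤ) : ℝ) * x) := by
    intro x
    rw [Complex.ofReal_pow, ← Complex.mul_conj', expSum, map_sum, Finset.sum_mul_sum]
    refine Finset.sum_congr rfl fun i _ => Finset.sum_congr rfl fun j _ => ?_
    rw [← circleExp_neg, ← circleExp_add]
    congr 1; push_cast; ring
  have h2 : ((∫ x in (0 : ℝ)..1, ‖expSum b k n x‖ ^ 2 : ℝ) : ℂ) = (n : ℂ) := by
    rw [← intervalIntegral.integral_ofReal]
    simp only [h]
    rw [intervalIntegral.integral_finsetSum fun i _ =>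
      (continuous_finsetSum _ fun j _ => hcont i j).intervalIntegrable _ _]
    calc _ = ∑ i ∈ Finset.range n, ∑ j ∈ Finset.range n, if i = j then (1 : ℂ) else 0 := by
          refine Finset.sum_congr rfl fun i _ => ?_
          rw [intervalIntegral.integral_finsetSum fun j _ => (hcont i j).intervalIntegrable _ _]
          refine Finset.sum_congr rfl fun j _ => ?_
          rw [integral_circleExp_intCast_mul]
          have : (k * b ^ i - k * b ^ j : ℤ) = 0 ↔ i = j := by
            rw [sub_eq_zero]
            constructor
            · intro h
              have h' : k * b ^ i = k * b ^ j := by exact_mod_cast h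
              exact Nat.pow_right_injective hb (Nat.eq_of_mul_eq_mul_left (by lia) h')
            · rintro rfl; rfl
          simp only [this]
      _ = n := by
          simp only [Finset.sum_ite_eq]
          rw [Finset.sum_congr rfl fun i hi => if_pos hi]
          simp
  exact_mod_cast h2

lemma ae_tendsto_expSum_sq {b k : ℕ} (hb : 2 ≤ b) (hk : k ≠ 0) :
    ∀ᵐ x ∂(MeasureTheory.volume.restrict (Ioc (0 : ℝ) 1)),
      Tendsto (fun s : ℕ => ‖expSum b k (s ^ 2) x‖ / (s : ℝ) ^ 2) atTop (𝓝 0) := by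
  have hc : ∀ s : ℕ, Continuous fun x : ℝ => (‖expSum b k (s ^ 2) x‖ / (s : ℝ) ^ 2) ^ 2 :=
    fun s => ((continuous_expSum _ _ _).norm.div_const _).pow 2
  have hint : ∀ s : ℕ, ∫⁻ x in Ioc (0 : ℝ) 1,
      ENNReal.ofReal ((‖expSum b k (s ^ 2) x‖ / (s : ℝ) ^ 2) ^ 2) =
      ENNReal.ofReal (1 / (s : ℝ) ^ 2) := by
    intro s
    rw [← MeasureTheory.ofReal_integral_eq_lintegral_ofReal
      ((hc s).integrableOn_Ioc) (Eventually.of_forall fun x => by positivity),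
      ← intervalIntegral.integral_of_le zero_le_one]
    simp only [div_pow]
    rw [intervalIntegral.integral_div, integral_norm_expSum_sq hb hk]
    congr 1
    rcases eq_or_ne s 0 with rfl | hs
    · simp
    · push_cast; field_simp
  have hfin : ∫⁻ x in Ioc (0 : ℝ) 1,
      ∑' s : ℕ, ENNReal.ofReal ((‖expSum b k (s ^ 2) x‖ / (s : ℝ) ^ 2) ^ 2) ≠ ⊤ := by
    rw [MeasureTheory.lintegral_tsum fun s => (hc s).measurable.ennreal_ofReal.aemeasurable]
    simp only [hint]
    exact (Real.summable_one_div_nat_pow.mpr one_lt_two).tsum_ofReal_ne_top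
  filter_upwards [MeasureTheory.ae_lt_top'
    (AEMeasurable.tsum fun s => (hc s).measurable.ennreal_ofReal.aemeasurable) hfin]
    with x hx
  have h1 := ENNReal.tendsto_atTop_zero_of_tsum_ne_top hx.ne
  have h2 := (ENNReal.tendsto_toReal ENNReal.zero_ne_top).comp h1
  have h3 := (Real.continuous_sqrt.tendsto _).comp h2
  simp only [ENNReal.toReal_zero, Real.sqrt_zero] at h3
  refine h3.congr fun s => ?_
  simp only [Function.comp]
  rw [ENNReal.toReal_ofReal (by positivity), Real.sqrt_sq (by positivity)]

/-- Convergence along the squares suffices, since consecutive squares are `O(√n)` apart. -/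
lemma tendsto_expSum_div_of_sq {b k : ℕ} {x : ℝ}
    (h : Tendsto (fun s : ℕ => ‖expSum b k (s ^ 2) x‖ / (s : ℝ) ^ 2) atTop (𝓝 0)) :
    Tendsto (fun n : ℕ => ‖expSum b k n x‖ / n) atTop (𝓝 0) := by
  have hs : Tendsto Nat.sqrt atTop atTop := by
    refine tendsto_atTop_atTop.mpr fun m => ⟨m * m, fun n hn => Nat.le_sqrt.mpr hn⟩
  have h1 := h.comp hs
  have h2 : Tendsto (fun n : ℕ => 2 * (1 / (Nat.sqrt n : ℝ))) atTop (𝓝 (2 * 0)) :=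
    (tendsto_one_div_atTop_nhds_zero_nat.comp hs).const_mul 2
  have h3 := h1.add h2
  simp only [mul_zero, add_zero] at h3
  refine squeeze_zero' (Eventually.of_forall fun n => by positivity) ?_ h3
  filter_upwards [eventually_ge_atTop 1] with n hn
  simp only [Function.comp]
  set s := Nat.sqrt n with hsdef
  have hs1 : 1 ≤ s := Nat.le_sqrt.mpr (by lia)
  have hsn : s ^ 2 ≤ n := by rw [pow_two]; exact Nat.sqrt_le n
  have hns : n - s ^ 2 ≤ 2 * s := by
    have := Nat.sqrt_le_add n
    rw [← hsdef] at this
    rw [pow_two]; lia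
  have h4 : ‖expSum b k n x‖ ≤ ‖expSum b k (s ^ 2) x‖ + 2 * s := by
    have h5 := expSum_add b k (s ^ 2) (n - s ^ 2) x
    rw [Nat.add_sub_cancel' hsn] at h5
    rw [h5]
    refine (norm_add_le _ _).trans (add_le_add le_rfl ((norm_expSum_le _ _ _ _).trans ?_))
    exact_mod_cast hns
  have hs0 : (0 : ℝ) < s := by exact_mod_cast hs1
  have hsn' : (s : ℝ) ^ 2 ≤ n := by exact_mod_cast hsn
  calc ‖expSum b k n x‖ / n ≤ (‖expSum b k (s ^ 2) x‖ + 2 * s) / n := by gcongr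
    _ ≤ (‖expSum b k (s ^ 2) x‖ + 2 * s) / (s : ℝ) ^ 2 := by gcongr
    _ = _ := by field_simp

lemma ae_tendsto_weylSum {b : ℕ} (hb : 2 ≤ b) :
    ∀ᵐ x ∂(MeasureTheory.volume.restrict (Ioc (0 : ℝ) 1)),
      Tendsto (fun n : ℕ => weylSum b n x / n) atTop (𝓝 0) := by
  filter_upwards [MeasureTheory.ae_all_iff.mpr fun k : ℕ =>
    ae_tendsto_expSum_sq (k := k + 1) hb k.succ_ne_zero] with x hx
  exact tendsto_weylSum_div fun k => tendsto_expSum_div_of_sq (hx k)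

/-- The points whose base-`b` orbit is equidistributed with precision `ε` at all times, up to an
additive error `R`. -/
def goodSet (b : ℕ) (ε R : ℝ) : Set ℝ := {x | ∀ n : ℕ, weylSum b n x ≤ ε * n + R}

lemma isClosed_goodSet (b : ℕ) (ε R : ℝ) : IsClosed (goodSet b ε R) := by
  simp only [goodSet, ofPred_forall]
  exact isClosed_iInter fun n => isClosed_le (continuous_weylSum b n) continuous_const

lemma add_intCast_mem_goodSet {b : ℕ} {ε R x : ℝ} (t : ℤ) :
    x + t ∈ goodSet b ε R ↔ x ∈ goodSet b ε R := by
  simp only [goodSet, mem_ofPred_eq, weylSum_add_intCast]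

lemma exists_measure_compl_goodSet_lt {b : ℕ} (hb : 2 ≤ b) {ε δ : ℝ} (hε : 0 < ε) (hδ : 0 < δ) :
    ∃ R : ℝ, 0 ≤ R ∧
      MeasureTheory.volume ((goodSet b ε R)ᶜ ∩ Ioc 0 1) < ENNReal.ofReal δ := by
  have hanti : Antitone fun R : ℕ => (goodSet b ε R)ᶜ ∩ Ioc (0 : ℝ) 1 := by
    intro R S hRS
    refine inter_subset_inter_left _ (compl_subset_compl.mpr fun x hx n => (hx n).trans ?_)
    have : (R : ℝ) ≤ S := by exact_mod_cast hRS
    linarith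
  have hmeas : ∀ R : ℕ, MeasurableSet ((goodSet b ε R)ᶜ ∩ Ioc (0 : ℝ) 1) := fun R =>
    (isClosed_goodSet b ε R).measurableSet.compl.inter measurableSet_Ioc
  have hlim := MeasureTheory.tendsto_measure_iInter_atTop (μ := MeasureTheory.volume)
    (fun R => (hmeas R).nullMeasurableSet) hanti
    ⟨0, (lt_of_le_of_lt (MeasureTheory.measure_mono inter_subset_right) (by simp)).ne⟩
  have hzero : MeasureTheory.volume (⋂ R : ℕ, (goodSet b ε R)ᶜ ∩ Ioc (0 : ℝ) 1) = 0 := by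
    have h := (MeasureTheory.ae_restrict_iff' measurableSet_Ioc).mp (ae_tendsto_weylSum hb)
    refine MeasureTheory.measure_mono_null ?_ (MeasureTheory.ae_iff.mp h)
    intro x hx hx'
    have hx0 := mem_iInter.mp hx
    have hxt := hx' (hx0 0).2
    obtain ⟨N, hN⟩ := eventually_atTop.mp (hxt.eventually (gt_mem_nhds hε))
    refine (hx0 N).1 fun n => ?_
    rcases le_or_gt N n with h1 | h1
    · rcases Nat.eq_zero_or_pos n with rfl | hn
      · refine (weylSum_le _ _ _).trans ?_
        simp
      · have h2 := hN n h1
        rw [div_lt_iff₀ (by exact_mod_cast hn)] at h2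
        have : (0 : ℝ) ≤ N := by positivity
        linarith
    · refine (weylSum_le _ _ _).trans ?_
      have h3 : (n : ℝ) ≤ N := by exact_mod_cast h1.le
      have : 0 ≤ ε * n := by positivity
      linarith
  rw [hzero] at hlim
  obtain ⟨R, hR⟩ := (hlim.eventually (gt_mem_nhds (ENNReal.ofReal_pos.mpr hδ))).exists
  exact ⟨R, by positivity, hR⟩

/-! ### Weyl's criterion -/

/-- The number of `i < n` such that the `r` base-`b` digits of `x` from position `i` on are those
of the integer `v < b ^ r`, written with `r` digits. -/
noncomputable def blockCount (b r v n : ℕ) (x : ℝ) : ℕ :=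
  {i ∈ Finset.range n | ⌊x * b ^ (i + r)⌋₊ % b ^ r = v}.card

lemma floor_mul_pow_div {b : ℕ} (hb : 0 < b) {x : ℝ} {i j k : ℕ} (hj : j < k) :
    ⌊x * b ^ (i + j + 1)⌋₊ = ⌊x * b ^ (i + k)⌋₊ / b ^ (k - 1 - j) := by
  have h : x * b ^ (i + j + 1) = x * b ^ (i + k) / ((b ^ (k - 1 - j) : ℕ) : ℝ) := by
    have hb' : (b : ℝ) ≠ 0 := by positivity
    have : i + k = i + j + 1 + (k - 1 - j) := by lia
    rw [this, eq_div_iff (by positivity)]; push_cast; rw [mul_assoc, ← pow_add]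
  rw [h, Nat.floor_div_natCast]

/-- Matching a word of digits is one congruence. `Fin.rev` appears because `finFunctionFinEquiv`
puts the least significant digit first. -/
lemma forall_digits_eq_iff {b : ℕ} [NeZero b] (x : ℝ) {k : ℕ} (u : Fin k → Fin b) (i : ℕ) :
    (∀ j : Fin k, Real.digits x b (i + j) = u j) ↔
      ⌊x * b ^ (i + k)⌋₊ % b ^ k = (finFunctionFinEquiv (u ∘ Fin.rev) : Fin (b ^ k)) := by
  have hb : 0 < b := NeZero.pos b
  set w := ⌊x * b ^ (i + k)⌋₊ with hw
  have h1 : w % b ^ k = (finFunctionFinEquiv (u ∘ Fin.rev) : Fin (b ^ k)) ↔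
      finFunctionFinEquiv.symm (⟨w % b ^ k, Nat.mod_lt _ (by positivity)⟩ : Fin (b ^ k)) =
        u ∘ Fin.rev := by
    rw [Equiv.symm_apply_eq, Fin.ext_iff]
  rw [h1, funext_iff]
  have h2 : ∀ j : Fin k, Real.digits x b (i + j) = u j ↔
      finFunctionFinEquiv.symm (⟨w % b ^ k, Nat.mod_lt _ (by positivity)⟩ : Fin (b ^ k))
        (Fin.rev j) = u j := by
    intro j
    rw [Fin.ext_iff, Fin.ext_iff, Real.digits, Fin.val_ofNat, finFunctionFinEquiv_symm_apply_val]
    rw [floor_mul_pow_div hb j.isLt, ← hw, Fin.val_rev]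
    have h3 : k - (j + 1) = k - 1 - (j : ℕ) := by lia
    have h4 : b ^ k = b ^ (k - 1 - (j : ℕ)) * b ^ ((j : ℕ) + 1) := by
      rw [← pow_add]; congr 1; have := j.isLt; lia
    simp only [h3]
    rw [h4, Nat.mod_mul_right_div_self, Nat.mod_mod_of_dvd _ (dvd_pow_self b (by lia))]
  constructor
  · intro h j
    have := (h2 (Fin.rev j)).mp (h _)
    rwa [Fin.rev_rev] at this
  · intro h j
    refine (h2 j).mpr ?_
    rw [h (Fin.rev j), Function.comp, Fin.rev_rev]

lemma wordCount_le_blockCount {b : ℕ} [NeZero b] (x : ℝ) {k : ℕ} (u : Fin k → Fin b) (n : ℕ) :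
    wordCount x u n ≤ blockCount b k (finFunctionFinEquiv (u ∘ Fin.rev) : Fin (b ^ k)) n x := by
  simp only [wordCount, blockCount, forall_digits_eq_iff]
  exact Finset.card_le_card fun i hi => by
    simp only [Finset.mem_filter] at hi ⊢; exact ⟨hi.1, hi.2.2⟩

lemma blockCount_le_wordCount_add {b : ℕ} [NeZero b] (x : ℝ) {k : ℕ} (u : Fin k → Fin b) (n : ℕ) :
    blockCount b k (finFunctionFinEquiv (u ∘ Fin.rev) : Fin (b ^ k)) n x ≤ wordCount x u n + k := by
  simp only [wordCount, blockCount, forall_digits_eq_iff]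
  refine (Finset.card_le_card (t := _ ∪ Finset.Ico (n - k) n) fun i hi => ?_).trans
    ((Finset.card_union_le _ _).trans (add_le_add le_rfl ?_))
  · simp only [Finset.mem_filter, Finset.mem_union, Finset.mem_Ico, Finset.mem_range] at hi ⊢
    by_cases h : i + k ≤ n
    · exact Or.inl ⟨hi.1, h, hi.2⟩
    · exact Or.inr ⟨by lia, hi.1⟩
  · simp only [Nat.card_Ico]; lia

lemma tendsto_wordCount_iff {b : ℕ} [NeZero b] (x : ℝ) {k : ℕ} (u : Fin k → Fin b) (l : ℝ) :
    Tendsto (fun n : ℕ => (wordCount x u n : ℝ) / n) atTop (𝓝 l) ↔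
    Tendsto (fun n : ℕ => (blockCount b k (finFunctionFinEquiv (u ∘ Fin.rev) : Fin (b ^ k)) n x : ℝ)
      / n) atTop (𝓝 l) := by
  have h0 : Tendsto (fun n : ℕ => (blockCount b k (finFunctionFinEquiv (u ∘ Fin.rev) : Fin (b ^ k))
      n x : ℝ) / n - (wordCount x u n : ℝ) / n) atTop (𝓝 0) := by
    refine squeeze_zero (fun n => ?_) (fun n => ?_) (tendsto_const_div_atTop_nhds_zero_nat (k : ℝ))
    · have : (wordCount x u n : ℝ) ≤ _ := Nat.cast_le.mpr (wordCount_le_blockCount x u n)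
      rw [sub_nonneg]
      gcongr
    · have : (_ : ℝ) ≤ _ := Nat.cast_le.mpr (blockCount_le_wordCount_add x u n)
      push_cast at this
      rw [← sub_div]
      gcongr
      linarith
  constructor
  · intro h
    simpa using h.add h0
  · intro h
    simpa using h.sub h0

lemma mem_normalNumbers_iff_blockCount {b : ℕ} [NeZero b] {x : ℝ} :
    x ∈ normalNumbers b ↔ x ∈ Ico (0 : ℝ) 1 ∧ ∀ r v : ℕ, v < b ^ r →
      Tendsto (fun n : ℕ => (blockCount b r v n x : ℝ) / n) atTop (𝓝 (1 / (b : ℝ) ^ r)) := by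
  refine and_congr_right fun _ => ⟨fun h r v hv => ?_, fun h r u => ?_⟩
  · have h1 := (tendsto_wordCount_iff x _ _).mp
      (h r (finFunctionFinEquiv.symm (⟨v, hv⟩ : Fin (b ^ r)) ∘ Fin.rev))
    have h2 : (finFunctionFinEquiv.symm (⟨v, hv⟩ : Fin (b ^ r)) ∘ Fin.rev) ∘ Fin.rev =
        finFunctionFinEquiv.symm (⟨v, hv⟩ : Fin (b ^ r)) := by
      ext j; simp
    rw [h2, Equiv.apply_symm_apply] at h1
    exact h1
  · exact (tendsto_wordCount_iff x _ _).mpr (h r _ (Fin.isLt _))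

lemma floor_mod_eq_iff {b r v i : ℕ} (hb : 0 < b) {x : ℝ} (hx : 0 ≤ x) :
    ⌊x * b ^ (i + r)⌋₊ % b ^ r = v ↔
      Int.fract (b ^ i * x) ∈ Ico ((v : ℝ) / b ^ r) ((v + 1) / b ^ r) := by
  have hbr : (0 : ℝ) < (b : ℝ) ^ r := by positivity
  set y := (b : ℝ) ^ i * x with hy
  have hy0 : 0 ≤ y := by positivity
  have h1 : x * b ^ (i + r) = Int.fract y * b ^ r + ((⌊y⌋₊ * b ^ r : ℕ) : ℝ) := by
    have h2 : Int.fract y + (⌊y⌋₊ : ℝ) = y := by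
      rw [natCast_floor_eq_intCast_floor hy0]; exact Int.fract_add_floor y
    push_cast
    rw [← add_mul, h2, hy, pow_add]; ring
  have hf : 0 ≤ Int.fract y * b ^ r := mul_nonneg (Int.fract_nonneg y) hbr.le
  have hlt : ⌊Int.fract y * b ^ r⌋₊ < b ^ r := by
    rw [Nat.floor_lt hf]
    push_cast
    exact mul_lt_of_lt_one_left hbr (Int.fract_lt_one y)
  rw [h1, Nat.floor_add_natCast hf, Nat.add_mul_mod_self_right, Nat.mod_eq_of_lt hlt,
    Nat.floor_eq_iff hf, mem_Ico, div_le_iff₀ hbr, lt_div_iff₀ hbr]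

lemma sum_circleExp_eq_zero {M k : ℕ} (hk : 0 < k) (hkM : k < M) :
    ∑ v ∈ Finset.range M, circleExp (k * (v / M)) = 0 := by
  have hM : (M : ℝ) ≠ 0 := by have : 0 < M := by lia
                              positivity
  have hne : circleExp (k / M) ≠ 1 := by
    rw [circleExp, Ne, Complex.exp_eq_one_iff]
    rintro ⟨t, ht⟩
    have h1 : ((2 * Real.pi * (k / M) : ℝ) : ℂ) = ((2 * Real.pi * t : ℝ) : ℂ) := by
      have := mul_right_cancel₀ Complex.I_ne_zero (ht.trans
        (by push_cast; ring : _ = ((2 * Real.pi * t : ℝ) : ℂ) * Complex.I))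
      exact this
    have h2 := mul_left_cancel₀ Real.two_pi_pos.ne' (Complex.ofReal_injective h1)
    rw [div_eq_iff hM] at h2
    have h3 : (k : ℤ) = t * M := by exact_mod_cast h2
    have h4 : (M : ℤ) ∣ k := ⟨t, by rw [h3]; ring⟩
    have := Nat.le_of_dvd hk (Int.natCast_dvd_natCast.mp h4)
    lia
  have hpow : ∀ v : ℕ, circleExp (k * (v / M)) = circleExp (k / M) ^ v := by
    intro v
    rw [circleExp, circleExp, ← Complex.exp_nat_mul]
    congr 1; push_cast; ring
  simp only [hpow]
  have h := mul_geom_sum (circleExp (k / M)) M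
  rw [← hpow M, div_self hM, mul_one] at h
  have h1 : circleExp k = 1 := by simpa using circleExp_intCast k
  rw [h1, sub_self] at h
  exact (mul_eq_zero.mp h).resolve_left (sub_ne_zero.mpr hne)

lemma norm_expSum_sub_blockCount_le {b : ℕ} (hb : 0 < b) (k r n : ℕ) {x : ℝ} (hx : 0 ≤ x) :
    ‖expSum b k n x - ∑ v ∈ Finset.range (b ^ r),
      (blockCount b r v n x : ℂ) * circleExp (k * (v / (b ^ r : ℕ)))‖ ≤
      2 * Real.pi * k / b ^ r * n := by
  have hbr : (0 : ℝ) < (b : ℝ) ^ r := by positivity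
  have hmaps : ∀ i ∈ Finset.range n, ⌊x * b ^ (i + r)⌋₊ % b ^ r ∈ Finset.range (b ^ r) :=
    fun i _ => Finset.mem_range.mpr (Nat.mod_lt _ (by positivity))
  have h1 : ∑ v ∈ Finset.range (b ^ r),
      (blockCount b r v n x : ℂ) * circleExp (k * (v / (b ^ r : ℕ))) =
      ∑ i ∈ Finset.range n,
        circleExp (k * ((⌊x * b ^ (i + r)⌋₊ % b ^ r : ℕ) / (b ^ r : ℕ))) := by
    rw [← Finset.sum_fiberwise_of_maps_to hmaps]
    refine Finset.sum_congr rfl fun v _ => ?_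
    rw [Finset.sum_congr rfl (g := fun _ => circleExp (k * (v / (b ^ r : ℕ))))
      fun i hi => by rw [(Finset.mem_filter.mp hi).2]]
    rw [Finset.sum_const, nsmul_eq_mul, blockCount]
  rw [h1, expSum, ← Finset.sum_sub_distrib]
  refine (norm_sum_le_of_le (n := fun _ => 2 * Real.pi * k / b ^ r) _ fun i _ => ?_).trans
    (by simp [mul_comm])
  set v := ⌊x * b ^ (i + r)⌋₊ % b ^ r with hv
  have h2 := (floor_mod_eq_iff hb hx).mp hv.symm
  have h3 : circleExp (k * b ^ i * x) = circleExp (k * Int.fract (b ^ i * x)) := by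
    have : (k * b ^ i * x : ℝ) = k * Int.fract (b ^ i * x) + ((k * ⌊b ^ i * x⌋ : ℤ) : ℝ) := by
      push_cast
      rw [← mul_add, Int.fract_add_floor, mul_assoc]
    rw [this, circleExp_add_intCast]
  rw [h3]
  refine (norm_circleExp_sub_le _ _).trans ?_
  rw [← mul_sub, abs_mul, abs_of_nonneg (by positivity : (0 : ℝ) ≤ k), mul_div_assoc]
  refine mul_le_mul_of_nonneg_left ?_ Real.two_pi_pos.le
  rw [div_eq_mul_inv (k : ℝ)]
  refine mul_le_mul_of_nonneg_left ?_ (by positivity)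
  push_cast
  rw [add_div, one_div] at h2
  rw [abs_le]
  constructor
  · have := h2.1
    have : (0 : ℝ) < ((b : ℝ) ^ r)⁻¹ := by positivity
    linarith
  · linarith [h2.2]

/-- Normal numbers have small exponential sums: approximate a character by a step function on the
`b`-adic intervals of length `b ^ (-r)`, and use that its values at their left endpoints sum to
zero. -/
lemma tendsto_expSum_of_mem_normalNumbers {b : ℕ} [NeZero b] (hb : 2 ≤ b) {x : ℝ}
    (hx : x ∈ normalNumbers b) {k : ℕ} (hk : 0 < k) :
    Tendsto (fun n : ℕ => ‖expSum b k n x‖ / n) atTop (𝓝 0) := by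
  obtain ⟨hx0, hblock⟩ := mem_normalNumbers_iff_blockCount.mp hx
  rw [Metric.tendsto_atTop]
  intro ε hε
  have hb1 : (1 : ℝ) < b := by exact_mod_cast hb
  have hpow := tendsto_pow_atTop_atTop_of_one_lt hb1
  obtain ⟨r, hr1, hr2⟩ := ((hpow.eventually_gt_atTop (k : ℝ)).and
    (hpow.eventually_gt_atTop (4 * Real.pi * k / ε))).exists
  have hbr : (0 : ℝ) < (b : ℝ) ^ r := by positivity
  have hkr : k < b ^ r := by exact_mod_cast hr1
  have hlim : Tendsto (fun n : ℕ => ∑ v ∈ Finset.range (b ^ r),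
      (((blockCount b r v n x : ℝ) / n : ℝ) : ℂ) * circleExp (k * (v / (b ^ r : ℕ)))) atTop
      (𝓝 (∑ v ∈ Finset.range (b ^ r),
        ((1 / (b : ℝ) ^ r : ℝ) : ℂ) * circleExp (k * (v / (b ^ r : ℕ))))) :=
    tendsto_finsetSum _ fun v hv => ((Complex.continuous_ofReal.tendsto _).comp
      (hblock r v (Finset.mem_range.mp hv))).mul_const _
  rw [← Finset.mul_sum, sum_circleExp_eq_zero hk hkr, mul_zero] at hlim
  obtain ⟨N, hN⟩ := Metric.tendsto_atTop.mp hlim (ε / 2) (by positivity)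
  refine ⟨max N 1, fun n hn => ?_⟩
  have hn0 : (0 : ℝ) < n := by
    have : 1 ≤ n := le_trans (le_max_right _ _) hn
    exact_mod_cast this
  have h1 := hN n (le_trans (le_max_left _ _) hn)
  rw [dist_zero_right] at h1 ⊢
  rw [Real.norm_of_nonneg (by positivity), div_lt_iff₀ hn0]
  have h2 := norm_expSum_sub_blockCount_le (b := b) (by lia) k r n hx0.1
  set S := ∑ v ∈ Finset.range (b ^ r),
      (blockCount b r v n x : ℂ) * circleExp (k * (v / (b ^ r : ℕ))) with hS
  have h3 : ∑ v ∈ Finset.range (b ^ r),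
      (((blockCount b r v n x : ℝ) / n : ℝ) : ℂ) * circleExp (k * (v / (b ^ r : ℕ))) = S / n := by
    rw [hS, Finset.sum_div]
    refine Finset.sum_congr rfl fun v _ => ?_
    push_cast; ring
  rw [h3, norm_div, Complex.norm_natCast, div_lt_iff₀ hn0] at h1
  have h4 : 2 * Real.pi * k / b ^ r < ε / 2 := by
    rw [div_lt_iff₀ hε] at hr2
    rw [div_lt_iff₀ hbr]
    linarith
  have h5 := norm_sub_norm_le (expSum b k n x) S
  have h6 : 2 * Real.pi * k / b ^ r * n < ε / 2 * n := mul_lt_mul_of_pos_right h4 hn0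
  linarith

open MeasureTheory in
/-- If all nontrivial character averages along a sequence tend to zero then the averages of every
continuous function on the circle tend to its integral, because trigonometric polynomials are
dense. -/
lemma tendsto_average_continuousMap {y : ℕ → ℝ}
    (h : ∀ k : ℕ, 0 < k →
      Tendsto (fun n : ℕ => ‖∑ j ∈ Finset.range n, circleExp (k * y j)‖ / n) atTop (𝓝 0))
    (f : C(UnitAddCircle, ℂ)) :
    Tendsto (fun n : ℕ => (n : ℂ)⁻¹ * ∑ j ∈ Finset.range n, f (y j : UnitAddCircle)) atTop
      (𝓝 (∫ t, f t)) := by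
  have hchar : ∀ (k : ℤ) (x : ℝ), fourier k (x : UnitAddCircle) = circleExp (k * x) := by
    intro k x
    rw [fourier_coe_apply, circleExp]
    congr 1; push_cast; ring
  have hpos : ∀ k : ℕ, 0 < k → Tendsto (fun n : ℕ =>
      (n : ℂ)⁻¹ * ∑ j ∈ Finset.range n, circleExp (k * y j)) atTop (𝓝 0) := by
    intro k hk
    rw [tendsto_zero_iff_norm_tendsto_zero]
    refine (h k hk).congr fun n => ?_
    rw [norm_mul, norm_inv, Complex.norm_natCast]; ring
  have hfourier : ∀ k : ℤ, Tendsto (fun n : ℕ =>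
      (n : ℂ)⁻¹ * ∑ j ∈ Finset.range n, fourier k (y j : UnitAddCircle)) atTop
      (𝓝 (∫ t : UnitAddCircle, fourier k t)) := by
    intro k
    have hint : ∫ t : UnitAddCircle, fourier k t = if k = 0 then 1 else 0 := by
      rw [← UnitAddCircle.intervalIntegral_preimage 0]
      simp only [hchar]
      rw [zero_add, integral_circleExp_intCast_mul]
    rw [hint]
    split_ifs with hk
    · subst hk
      refine tendsto_const_nhds.congr' ?_
      filter_upwards [eventually_ne_atTop 0] with n hn
      have hn' : (n : ℂ) ≠ 0 := by exact_mod_cast hn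
      simp [hn']
    · rcases lt_or_gt_of_ne hk with hk | hk
      · obtain ⟨m, hm⟩ := Int.eq_ofNat_of_zero_le (neg_nonneg.mpr hk.le)
        have h1 := (Complex.continuous_conj.tendsto _).comp (hpos m (by lia))
        rw [map_zero] at h1
        refine h1.congr fun n => ?_
        simp only [Function.comp, map_mul, map_inv₀, map_natCast, map_sum, hchar,
          ← circleExp_neg]
        have : (k : ℝ) = -(m : ℝ) := by
          have : k = -(m : ℤ) := by lia
          rw [this]; push_cast; ring
        simp only [this, neg_mul]
      · obtain ⟨m, hm⟩ := Int.eq_ofNat_of_zero_le hk.le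
        have h1 := hpos m (by lia)
        refine h1.congr fun n => ?_
        simp only [hchar, hm, Int.cast_natCast]
  have hintegrable : ∀ g : C(UnitAddCircle, ℂ), Integrable (fun t => g t) := fun g =>
    g.continuous.integrable_of_hasCompactSupport (HasCompactSupport.of_compactSpace _)
  have hspan : ∀ g ∈ Submodule.span ℂ (range (@fourier (1 : ℝ))), Tendsto (fun n : ℕ =>
      (n : ℂ)⁻¹ * ∑ j ∈ Finset.range n, g (y j : UnitAddCircle)) atTop (𝓝 (∫ t, g t)) := by
    intro g hg
    induction hg using Submodule.span_induction with
    | mem g hg => obtain ⟨k, rfl⟩ := hg; exact hfourier k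
    | zero => simp
    | add g g' _ _ ih ih' =>
      have h1 : ∫ t, (g + g') t = (∫ t, g t) + ∫ t, g' t :=
        integral_add (hintegrable g) (hintegrable g')
      rw [h1]
      refine (ih.add ih').congr fun n => ?_
      simp only [ContinuousMap.add_apply, Finset.sum_add_distrib, mul_add]
    | smul a g _ ih =>
      have h1 : ∫ t, (a • g) t = a * ∫ t, g t := by
        simp only [ContinuousMap.smul_apply, smul_eq_mul]
        exact integral_const_mul _ _
      rw [h1]
      refine (ih.const_mul a).congr fun n => ?_
      simp only [ContinuousMap.smul_apply, smul_eq_mul, ← Finset.mul_sum]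
      ring
  rw [Metric.tendsto_atTop]
  intro ε hε
  have hf : f ∈ (Submodule.span ℂ (range (@fourier (1 : ℝ)))).topologicalClosure := by
    rw [span_fourier_closure_eq_top]; trivial
  obtain ⟨g, hg, hfg⟩ := Metric.mem_closure_iff.mp hf (ε / 3) (by positivity)
  obtain ⟨N, hN⟩ := Metric.tendsto_atTop.mp (hspan g hg) (ε / 3) (by positivity)
  have hpt : ∀ t, ‖f t - g t‖ ≤ ε / 3 := fun t => by
    rw [← dist_eq_norm]; exact (ContinuousMap.dist_apply_le_dist t).trans hfg.le
  refine ⟨N, fun n hn => ?_⟩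
  have h1 := hN n hn
  have h2 : ‖(n : ℂ)⁻¹ * ∑ j ∈ Finset.range n, f (y j : UnitAddCircle) -
      (n : ℂ)⁻¹ * ∑ j ∈ Finset.range n, g (y j : UnitAddCircle)‖ ≤ ε / 3 := by
    rw [← mul_sub, ← Finset.sum_sub_distrib, norm_mul, norm_inv, Complex.norm_natCast]
    have := norm_sum_le_of_le (Finset.range n) fun j _ => hpt (y j : UnitAddCircle)
    rw [Finset.sum_const, Finset.card_range, nsmul_eq_mul] at this
    rcases Nat.eq_zero_or_pos n with rfl | hn0
    · simp; positivity
    · have hn' : (0 : ℝ) < n := by exact_mod_cast hn0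
      rw [inv_mul_le_iff₀ hn']; exact this
  have h3 : ‖(∫ t, f t) - ∫ t, g t‖ ≤ ε / 3 := by
    rw [← integral_sub (hintegrable f) (hintegrable g)]
    refine (norm_integral_le_of_norm_le_const (C := ε / 3) (Eventually.of_forall hpt)).trans ?_
    rw [Measure.real, UnitAddCircle.measure_univ]; simp
  rw [dist_eq_norm] at h1 ⊢
  calc _ = ‖((n : ℂ)⁻¹ * ∑ j ∈ Finset.range n, f (y j : UnitAddCircle) -
        (n : ℂ)⁻¹ * ∑ j ∈ Finset.range n, g (y j : UnitAddCircle)) +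
        ((n : ℂ)⁻¹ * ∑ j ∈ Finset.range n, g (y j : UnitAddCircle) - ∫ t, g t) -
        ((∫ t, f t) - ∫ t, g t)‖ := by congr 1; ring
    _ ≤ _ + _ := norm_sub_le _ _
    _ ≤ _ + _ + _ := add_le_add (norm_add_le _ _) le_rfl
    _ < ε := by linarith

open MeasureTheory in
/-- The uniform probability measure on the first `n + 1` terms of a sequence in the circle. -/
noncomputable def empiricalMeasure (y : ℕ → ℝ) (n : ℕ) : ProbabilityMeasure UnitAddCircle :=
  ⟨((n + 1 : ℕ) : ENNReal)⁻¹ • ∑ j ∈ Finset.range (n + 1), Measure.dirac (y j : UnitAddCircle), by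
    constructor
    simp only [Measure.smul_apply, Measure.finsetSum_apply, measure_univ, smul_eq_mul,
      Finset.sum_const, Finset.card_range, nsmul_eq_mul, mul_one]
    exact ENNReal.inv_mul_cancel (by simp) (ENNReal.natCast_ne_top _)⟩

open MeasureTheory in
/-- Lebesgue measure on the circle `ℝ / ℤ`, as a bundled probability measure. -/
noncomputable def circleVolume : ProbabilityMeasure UnitAddCircle :=
  ⟨volume, ⟨UnitAddCircle.measure_univ⟩⟩

open MeasureTheory in
lemma tendsto_empiricalMeasure {y : ℕ → ℝ}
    (h : ∀ k : ℕ, 0 < k →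
      Tendsto (fun n : ℕ => ‖∑ j ∈ Finset.range n, circleExp (k * y j)‖ / n) atTop (𝓝 0)) :
    Tendsto (empiricalMeasure y) atTop (𝓝 circleVolume) := by
  rw [ProbabilityMeasure.tendsto_iff_forall_integral_rclike_tendsto ℂ]
  intro f
  refine ((tendsto_average_continuousMap h f.toContinuousMap).comp (tendsto_add_atTop_nat 1)).congr
    fun n => ?_
  have h1 : ∀ j ∈ Finset.range (n + 1),
      Integrable (fun t => f t) (Measure.dirac (y j : UnitAddCircle)) := fun j _ =>
    f.integrable _
  change _ = ∫ t, f t ∂(((n + 1 : ℕ) : ENNReal)⁻¹ •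
    ∑ j ∈ Finset.range (n + 1), Measure.dirac (y j : UnitAddCircle))
  rw [integral_smul_measure, integral_finsetSum_measure h1]
  simp only [integral_dirac, Function.comp]
  rw [ENNReal.toReal_inv, ENNReal.toReal_natCast, Complex.real_smul]
  push_cast; rfl

/-- The half-open arc of the circle consisting of the classes of the points of `[α, β)`. -/
def circleArc (α β : ℝ) : Set UnitAddCircle := (fun x : ℝ => (x : UnitAddCircle)) '' Ico α β

lemma coe_mem_circleArc_iff {α β : ℝ} (hα : 0 ≤ α) (hβ : β ≤ 1) (x : ℝ) :
    (x : UnitAddCircle) ∈ circleArc α β ↔ Int.fract x ∈ Ico α β := by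
  have hx : (x : UnitAddCircle) = (Int.fract x : ℝ) := by
    rw [← sub_eq_zero, ← AddCircle.coe_sub, AddCircle.coe_eq_zero_iff]
    exact ⟨⌊x⌋, by rw [zsmul_eq_mul, mul_one, Int.self_sub_fract]⟩
  rw [hx]
  constructor
  · rintro ⟨y, hy, hyx⟩
    have h1 : y = Int.fract x := (AddCircle.coe_eq_coe_iff_of_mem_Ico (p := (1 : ℝ)) (a := 0)
      ⟨hα.trans hy.1, by linarith [hy.2]⟩
      ⟨Int.fract_nonneg x, by linarith [Int.fract_lt_one x]⟩).mp hyx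
    exact h1 ▸ hy
  · exact fun h => ⟨_, h, rfl⟩

lemma volume_singleton_unitAddCircle (t : UnitAddCircle) : MeasureTheory.volume {t} = 0 := by
  rw [← Metric.closedBall_zero, AddCircle.volume_closedBall]; simp

lemma isOpen_coe_image_Ioo (α β : ℝ) :
    IsOpen ((fun x : ℝ => (x : UnitAddCircle)) '' Ioo α β) :=
  QuotientAddGroup.isOpenMap_coe _ isOpen_Ioo

lemma measurableSet_circleArc (α β : ℝ) : MeasurableSet (circleArc α β) := by
  rcases lt_or_ge α β with h | h
  · rw [circleArc, ← Ioo_insert_left h, image_insert_eq]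
    exact (isOpen_coe_image_Ioo α β).measurableSet.insert _
  · simp [circleArc, Ico_eq_empty_of_le h]

lemma volume_circleArc {α β : ℝ} (hα : 0 ≤ α) (hβ : β ≤ 1) :
    MeasureTheory.volume (circleArc α β) = ENNReal.ofReal (β - α) := by
  rw [AddCircle.add_projection_respects_measure 1 0 (measurableSet_circleArc α β)]
  have hpre : ∀ x : ℝ, x ∈ QuotientAddGroup.mk ⁻¹' circleArc α β ↔ Int.fract x ∈ Ico α β :=
    coe_mem_circleArc_iff hα hβ
  refine le_antisymm ?_ ?_
  · calc _ ≤ MeasureTheory.volume (Ico α β ∪ {1}) := by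
          refine MeasureTheory.measure_mono fun x hx => ?_
          have h1 := (hpre x).mp hx.1
          rcases eq_or_lt_of_le hx.2.2 with h2 | h2
          · right; rw [mem_singleton_iff, h2, zero_add]
          · left
            rwa [Int.fract_eq_self.mpr ⟨hx.2.1.le, by linarith⟩] at h1
      _ ≤ MeasureTheory.volume (Ico α β) + MeasureTheory.volume ({1} : Set ℝ) :=
          MeasureTheory.measure_union_le _ _
      _ = _ := by rw [Real.volume_Ico, Real.volume_singleton, add_zero]
  · rw [← Real.volume_Ioo]
    refine MeasureTheory.measure_mono fun x hx => ⟨(hpre x).mpr ?_, ?_, ?_⟩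
    · rw [Int.fract_eq_self.mpr ⟨hα.trans hx.1.le, hx.2.trans_le hβ⟩]
      exact ⟨hx.1.le, hx.2⟩
    · exact hα.trans_lt hx.1
    · linarith [hx.2]

lemma volume_frontier_circleArc (α β : ℝ) :
    MeasureTheory.volume (frontier (circleArc α β)) = 0 := by
  have hcl : closure (circleArc α β) ⊆ (fun x : ℝ => (x : UnitAddCircle)) '' Icc α β :=
    closure_minimal (image_mono Ico_subset_Icc_self)
      (isCompact_Icc.image (AddCircle.continuous_mk' _)).isClosed
  have hint : (fun x : ℝ => (x : UnitAddCircle)) '' Ioo α β ⊆ interior (circleArc α β) :=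
    interior_maximal (image_mono Ioo_subset_Ico_self) (isOpen_coe_image_Ioo α β)
  refine MeasureTheory.measure_mono_null
    (t := {(α : UnitAddCircle)} ∪ {(β : UnitAddCircle)}) ?_
    (MeasureTheory.measure_union_null (volume_singleton_unitAddCircle _)
      (volume_singleton_unitAddCircle _))
  rintro t ⟨ht1, ht2⟩
  obtain ⟨x, hx, rfl⟩ := hcl ht1
  rcases eq_or_lt_of_le hx.1 with h | h
  · left; rw [h]; rfl
  · rcases eq_or_lt_of_le hx.2 with h' | h'
    · right; rw [h']; rfl
    · exact absurd (hint ⟨x, ⟨h, h'⟩, rfl⟩) ht2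

open MeasureTheory in
lemma empiricalMeasure_circleArc (y : ℕ → ℝ) (n : ℕ) {α β : ℝ} (hα : 0 ≤ α) (hβ : β ≤ 1)  :
    (empiricalMeasure y n (circleArc α β) : ℝ) =
      ({j ∈ Finset.range (n + 1) | Int.fract (y j) ∈ Ico α β}.card : ℝ) / (n + 1 : ℕ) := by
  classical
  have h : (empiricalMeasure y n : Measure UnitAddCircle) (circleArc α β) =
      ((n + 1 : ℕ) : ENNReal)⁻¹ *
        ({j ∈ Finset.range (n + 1) | Int.fract (y j) ∈ Ico α β}.card : ENNReal) := by
    change (((n + 1 : ℕ) : ENNReal)⁻¹ •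
      ∑ j ∈ Finset.range (n + 1), Measure.dirac (y j : UnitAddCircle)) (circleArc α β) = _
    rw [Measure.smul_apply, Measure.finsetSum_apply, smul_eq_mul, Finset.card_filter]
    push_cast
    congr 1
    refine Finset.sum_congr rfl fun j _ => ?_
    rw [Measure.dirac_apply' _ (measurableSet_circleArc α β), indicator_apply]
    simp only [coe_mem_circleArc_iff hα hβ, Pi.one_apply]
  change ((empiricalMeasure y n : Measure UnitAddCircle) (circleArc α β)).toReal = _
  rw [h, ENNReal.toReal_mul, ENNReal.toReal_inv, ENNReal.toReal_natCast, ENNReal.toReal_natCast]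
  ring

/-- Numbers with small exponential sums are normal: the empirical measures of the orbit tend weakly
to Lebesgue measure, and a digit block corresponds to an arc, whose boundary is a null set. -/
lemma mem_normalNumbers_of_tendsto_expSum {b : ℕ} [NeZero b] {x : ℝ} (hx : x ∈ Ico (0 : ℝ) 1)
    (h : ∀ k : ℕ, 0 < k → Tendsto (fun n : ℕ => ‖expSum b k n x‖ / n) atTop (𝓝 0)) :
    x ∈ normalNumbers b := by
  have hb : 0 < b := NeZero.pos b
  refine mem_normalNumbers_iff_blockCount.mpr ⟨hx, fun r v hv => ?_⟩
  have hbr : (0 : ℝ) < (b : ℝ) ^ r := by positivity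
  have hα : 0 ≤ (v : ℝ) / b ^ r := by positivity
  have hβ : ((v : ℝ) + 1) / b ^ r ≤ 1 := by
    rw [div_le_one hbr]; exact_mod_cast hv
  have hweak := tendsto_empiricalMeasure (y := fun j => b ^ j * x) fun k hk => by
    simp only [← mul_assoc]; exact h k hk
  have h1 := MeasureTheory.ProbabilityMeasure.tendsto_measure_of_null_frontier_of_tendsto hweak
    (E := circleArc ((v : ℝ) / b ^ r) ((v + 1) / b ^ r))
    (by
      rw [MeasureTheory.ProbabilityMeasure.null_iff_toMeasure_null]
      exact volume_frontier_circleArc _ _)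
  have h2 := (NNReal.continuous_coe.tendsto _).comp h1
  have h3 : (circleVolume (circleArc ((v : ℝ) / b ^ r) ((v + 1) / b ^ r)) : ℝ) =
      1 / (b : ℝ) ^ r := by
    change (MeasureTheory.volume (circleArc ((v : ℝ) / b ^ r) ((v + 1) / b ^ r))).toReal = _
    rw [volume_circleArc hα hβ, ENNReal.toReal_ofReal]
    · ring
    · rw [← sub_div]; simp
  rw [h3] at h2
  rw [← tendsto_add_atTop_iff_nat 1]
  refine h2.congr fun n => ?_
  simp only [Function.comp]
  rw [empiricalMeasure_circleArc _ _ hα hβ, blockCount]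
  simp only [floor_mod_eq_iff hb hx.1]

theorem mem_normalNumbers_iff {b : ℕ} [NeZero b] (hb : 2 ≤ b) {x : ℝ} :
    x ∈ normalNumbers b ↔
      x ∈ Ico (0 : ℝ) 1 ∧ Tendsto (fun n : ℕ => weylSum b n x / n) atTop (𝓝 0) := by
  constructor
  · exact fun h => ⟨h.1, tendsto_weylSum_div fun k =>
      tendsto_expSum_of_mem_normalNumbers hb h k.succ_pos⟩
  · rintro ⟨hx, h⟩
    refine mem_normalNumbers_of_tendsto_expSum hx fun k hk => ?_
    obtain ⟨k, rfl⟩ := Nat.exists_eq_succ_of_ne_zero hk.ne'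
    have h1 := h.const_mul (2 ^ (k + 1))
    rw [mul_zero] at h1
    refine squeeze_zero (fun n => by positivity) (fun n => ?_) h1
    rw [← mul_div_assoc]
    exact div_le_div_of_nonneg_right (norm_expSum_le_weylSum b k n x) (by positivity)

/-! ### The third level of the Borel hierarchy -/

section BorelHierarchy

variable {X : Type*} [TopologicalSpace X]

lemma not_isSigma0_zero (s : Set X) : ¬ IsSigma0 0 s := by
  intro h
  cases h with
  | iUnion m A hm hA => exact absurd (hm 0) (Nat.not_lt_zero _)

lemma IsSigma0.isOpen {s : Set X} (h : IsSigma0 1 s) : IsOpen s := by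
  cases h with
  | of_isOpen hs => exact hs
  | iUnion m A hm hA =>
    have h1 := hA 0
    rw [Nat.lt_one_iff.mp (hm 0)] at h1
    exact absurd h1 (not_isSigma0_zero _)

lemma isSigma0_two_compl_of_isGδ {s : Set X} (h : IsGδ s) : IsSigma0 2 sᶜ := by
  obtain ⟨f, hf, rfl⟩ := isGδ_iff_eq_iInter_nat.mp h
  rw [compl_iInter]
  exact .iUnion (fun _ => 1) _ (fun _ => one_lt_two) fun k => by
    rw [compl_compl]; exact .of_isOpen (hf k)

lemma isSigma0_three_of_isGδ {ι : Type*} [Countable ι] [Nonempty ι] {s : ι → Set X}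
    (h : ∀ i, IsGδ (s i)) : IsSigma0 3 (⋃ i, s i) := by
  obtain ⟨e, he⟩ := exists_surjective_nat ι
  rw [← he.iUnion_comp]
  exact .iUnion (fun _ => 2) _ (fun _ => by norm_num) fun k => isSigma0_two_compl_of_isGδ (h _)

variable [TopologicalSpace.MetrizableSpace X]

lemma IsSigma0.isGδ_compl {n : ℕ} (hn : n < 3) {s : Set X} (h : IsSigma0 n s) : IsGδ sᶜ := by
  let _ := TopologicalSpace.metrizableSpaceMetric X
  cases h with
  | of_isOpen hs => exact hs.isClosed_compl.isGδ
  | iUnion m A hm hA =>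
    rw [compl_iUnion]
    refine .iInter_of_isOpen fun k => ?_
    have hk : m k = 0 ∨ m k = 1 := by have := hm k; lia
    rcases hk with hk | hk
    · have h1 := hA k
      rw [hk] at h1
      exact absurd h1 (not_isSigma0_zero _)
    · have h1 := hA k
      rw [hk] at h1
      exact h1.isOpen

lemma IsPi0.exists_isGδ {A : Set X} (h : IsPi0 3 A) :
    ∃ G : ℕ → Set X, (∀ k, IsGδ (G k)) ∧ A = ⋂ k, (G k)ᶜ := by
  let _ := TopologicalSpace.metrizableSpaceMetric X
  generalize hs : Aᶜ = s at h
  unfold IsPi0 at h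
  rw [hs] at h
  generalize hn : 3 = n at h
  cases h with
  | of_isOpen hs' => lia
  | iUnion m F hm hF =>
    subst hn
    refine ⟨F, fun k => ?_, ?_⟩
    · have := (hF k).isGδ_compl (hm k)
      rwa [compl_compl] at this
    · rw [← compl_iUnion, ← hs, compl_compl]

end BorelHierarchy

section ZeroDimensional

variable {X : Type*} [TopologicalSpace X] [SecondCountableTopology X]
  [HasSmallInductiveDimensionLE X 0]

lemma IsOpen.exists_disjoint_isClopen {U : Set X} (hU : IsOpen U) :
    ∃ D : ℕ → Set X, (∀ s, IsClopen (D s)) ∧ Pairwise (Function.onFun Disjoint D) ∧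
      ⋃ s, D s = U := by
  have hbasis : TopologicalSpace.IsTopologicalBasis {s : Set X | IsClopen s} :=
    hasSmallInductiveDimensionLT_one_iff.mp inferInstance
  obtain ⟨S, hS, hSU⟩ := hbasis.open_eq_sUnion hU
  obtain ⟨T, hTc, hTS, hTU⟩ := TopologicalSpace.isOpen_sUnion_countable S fun s hs => (hS hs).isOpen
  obtain ⟨f, hf⟩ := (hTc.insert ∅).exists_eq_range (insert_nonempty _ _)
  have hfc : ∀ s, IsClopen (f s) := fun s => by
    rcases (hf ▸ mem_range_self s : f s ∈ insert ∅ T) with h | h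
    · rw [h]; exact isClopen_empty
    · exact hS (hTS h)
  refine ⟨disjointed f, fun s => ?_, disjoint_disjointed f, ?_⟩
  · exact disjointedRec (p := IsClopen) (fun _ i ht => ht.diff (hfc i)) (hfc s)
  · rw [iUnion_disjointed, hSU, ← hTU, ← sUnion_range, ← hf, sUnion_insert, empty_union]

/-- A `G_δ` set in a zero-dimensional space is the upper limit of a sequence of clopen sets: write
it as a decreasing intersection of open sets, and partition each of these into clopen pieces. -/
lemma IsGδ.exists_isClopen_limsup {G : Set X} (hG : IsGδ G) :
    ∃ D : ℕ → Set X, (∀ s, IsClopen (D s)) ∧ ∀ x, x ∈ G ↔ {s | x ∈ D s}.Infinite := by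
  obtain ⟨O, hO, rfl⟩ := isGδ_iff_eq_iInter_nat.mp hG
  have hO' : ∀ j, IsOpen (⋂ i ∈ Iic j, O i) := fun j =>
    (finite_Iic j).isOpen_biInter fun i _ => hO i
  choose E hE hdisj hEO using fun j => (hO' j).exists_disjoint_isClopen
  refine ⟨fun n => E n.unpair.1 n.unpair.2, fun n => hE _ _, fun x => ⟨fun hx => ?_, fun h => ?_⟩⟩
  · have h1 : ∀ j, ∃ s, x ∈ E j s := fun j => by
      rw [← mem_iUnion, hEO]
      exact mem_iInter₂.mpr fun i _ => mem_iInter.mp hx i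
    choose s hs using h1
    refine infinite_of_injective_forall_mem (f := fun j => Nat.pair j (s j))
      (fun a b hab => (Nat.pair_eq_pair.mp hab).1) fun j => ?_
    simp only [mem_ofPred_eq, Nat.unpair_pair]
    exact hs j
  · by_contra hx
    obtain ⟨j, hj⟩ : ∃ j, x ∉ O j := by simpa using hx
    have hmem : ∀ n : ℕ, x ∈ E n.unpair.1 n.unpair.2 → ∀ i ≤ n.unpair.1, x ∈ O i := fun n hn i hi => by
      have h1 := mem_iUnion_of_mem n.unpair.2 hn
      rw [hEO] at h1
      exact mem_iInter₂.mp h1 i hi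
    refine h (Finite.of_injOn (t := Iio j) (f := fun n : ℕ => n.unpair.1) (fun n hn => ?_)
      (fun m hm n hn hmn => ?_) (finite_Iio j))
    · exact not_le.mp fun hle => hj (hmem n hn j hle)
    · simp only at hmn
      have h1 : m.unpair.2 = n.unpair.2 := by
        by_contra hne
        have hm' : x ∈ E n.unpair.1 m.unpair.2 := hmn ▸ hm
        exact disjoint_left.mp (hdisj n.unpair.1 hne) hm' hn
      rw [← Nat.pair_unpair m, ← Nat.pair_unpair n, hmn, h1]

end ZeroDimensional

/-- Every `Π⁰₃` set in a zero-dimensional space is the continuous preimage of the set of sequences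
of natural numbers which tend to infinity. -/
lemma IsPi0.exists_continuous_tendsto_atTop {X : Type*} [TopologicalSpace X] [PolishSpace X]
    [HasSmallInductiveDimensionLE X 0] {A : Set X} (hA : IsPi0 3 A) :
    ∃ z : X → ℕ → ℕ, Continuous z ∧ ∀ x, x ∈ A ↔ Tendsto (z x) atTop atTop := by
  classical
  obtain ⟨G, hG, rfl⟩ := hA.exists_isGδ
  choose D hD hDG using fun k => (hG k).exists_isClopen_limsup
  refine ⟨fun x n => if x ∈ D n.unpair.1 n.unpair.2 then n.unpair.1 else n, ?_, fun x => ?_⟩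
  · refine continuous_pi fun n => ?_
    exact (continuous_const).if (fun x hx => by
      rw [ofPred_mem_eq, (hD _ _).frontier_eq] at hx; exact absurd hx (notMem_empty _)) continuous_const
  · rw [mem_iInter]
    simp only [mem_compl_iff, hDG, not_infinite]
    constructor
    · intro h
      refine tendsto_atTop.mpr fun M => ?_
      rw [← Nat.cofinite_eq_atTop, eventually_cofinite]
      refine ((finite_Iio M).union ((finite_Iio M).biUnion
        fun k _ => (h k).image fun s => Nat.pair k s)).subset fun n hn => ?_
      rw [mem_ofPred_eq, not_le] at hn
      split_ifs at hn with h1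
      · right
        exact mem_biUnion hn ⟨_, h1, Nat.pair_unpair n⟩
      · exact Or.inl hn
    · intro h k
      have h1 := h.eventually_gt_atTop k
      rw [← Nat.cofinite_eq_atTop, eventually_cofinite] at h1
      refine ((h1.preimage (f := Nat.pair k) (fun a _ b _ hab => (Nat.pair_eq_pair.mp hab).2))).subset
        fun s hs => ?_
      rw [mem_preimage, mem_ofPred_eq, Nat.unpair_pair]
      simp only
      rw [if_pos (show x ∈ D k s from hs)]; exact lt_irrefl _

/-- Normality is a `Π⁰₃` condition: by Weyl's criterion it says that a sequence of continuous
functions tends to zero. -/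
lemma isPi0_normalNumbers {b : ℕ} [NeZero b] (hb : 2 ≤ b) : IsPi0 3 (normalNumbers b) := by
  have h : (normalNumbers b)ᶜ = ⋃ i : Option (Option ℕ), i.elim (Iio (0 : ℝ)) fun j =>
      j.elim (Ici (1 : ℝ)) fun t => ⋂ N : ℕ, ⋃ n : ℕ, ⋃ _ : N ≤ n,
        {x : ℝ | 1 / (t + 1 : ℝ) < weylSum b n x / n} := by
    ext x
    simp only [mem_compl_iff, mem_normalNumbers_iff hb, iUnion_option, Option.elim, mem_union,
      mem_iUnion, mem_iInter, mem_Iio, mem_Ici, mem_ofPred_eq, mem_Ico]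
    rw [Metric.tendsto_atTop]
    simp only [dist_zero_right]
    have hn : ∀ n : ℕ, ‖weylSum b n x / n‖ = weylSum b n x / n := fun n =>
      Real.norm_of_nonneg (div_nonneg (weylSum_nonneg b n x) (Nat.cast_nonneg n))
    simp only [hn]
    constructor
    · intro h
      by_contra! h'
      refine h ⟨⟨h'.1, h'.2.1⟩, fun ε hε => ?_⟩
      obtain ⟨t, ht⟩ := exists_nat_one_div_lt hε
      obtain ⟨N, hN⟩ := h'.2.2 t
      exact ⟨N, fun n hn => (hN n hn).trans_lt ht⟩
    · rintro (h | h | ⟨t, ht⟩) ⟨⟨h0, h1⟩, hlim⟩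
      · linarith
      · linarith
      · obtain ⟨N, hN⟩ := hlim (1 / (t + 1)) (by positivity)
        obtain ⟨n, hn, hlt⟩ := ht N
        exact lt_asymm hlt (hN n hn)
  rw [IsPi0, h]
  refine isSigma0_three_of_isGδ fun i => ?_
  rcases i with _ | _ | t
  · exact isOpen_Iio.isGδ
  · exact isClosed_Ici.isGδ
  · exact .iInter_of_isOpen fun N => isOpen_iUnion fun n => isOpen_iUnion fun _ =>
      isOpen_lt continuous_const ((continuous_weylSum b n).div_const _)

/-! ### Choosing a point equidistributed in one base with a run of zeros in the other -/

/-- The number of base-`g` digits determined by an interval of length `l`. -/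
noncomputable def scale (g : ℕ) (l : ℝ) : ℕ := Nat.log g ⌊1 / l⌋₊

lemma pow_scale_mul_le {g : ℕ} {l : ℝ} (hl : 0 < l) (hl1 : l ≤ 1) :
    (g : ℝ) ^ scale g l * l ≤ 1 := by
  have h1 : (1 : ℝ) ≤ 1 / l := by rw [le_div_iff₀ hl]; linarith
  have h2 : ⌊1 / l⌋₊ ≠ 0 := by
    have := (Nat.one_le_floor_iff _).mpr h1
    lia
  have h3 : ((g ^ scale g l : ℕ) : ℝ) ≤ 1 / l :=
    (Nat.cast_le.mpr (Nat.pow_log_le_self g h2)).trans (Nat.floor_le (by positivity))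
  rw [le_div_iff₀ hl] at h3
  exact_mod_cast h3

lemma lt_pow_scale_succ_mul {g : ℕ} (hg : 2 ≤ g) {l : ℝ} (hl : 0 < l) :
    1 < (g : ℝ) ^ (scale g l + 1) * l := by
  have h1 : ⌊1 / l⌋₊ < g ^ (scale g l + 1) := Nat.lt_pow_succ_log_self hg _
  have h2 := (Nat.floor_lt (by positivity)).mp h1
  rw [div_lt_iff₀ hl] at h2
  exact_mod_cast h2

lemma le_scale {g : ℕ} (hg : 2 ≤ g) {l : ℝ} (hl : 0 < l) {n : ℕ} (h : (g : ℝ) ^ n * l ≤ 1) :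
    n ≤ scale g l := by
  have hg1 : (1 : ℝ) < g := by exact_mod_cast hg
  have h1 := lt_of_mul_lt_mul_right (h.trans_lt (lt_pow_scale_succ_mul hg hl)) hl.le
  exact Nat.lt_succ_iff.mp ((pow_lt_pow_iff_right₀ hg1).mp h1)

lemma volume_compl_goodSet_inter_Ioc (b : ℕ) (ε R t : ℝ) :
    MeasureTheory.volume ((goodSet b ε R)ᶜ ∩ Ioc t (t + 1)) =
      MeasureTheory.volume ((goodSet b ε R)ᶜ ∩ Ioc 0 1) := by
  set U : Set UnitAddCircle := (fun x : ℝ => (x : UnitAddCircle)) '' (goodSet b ε R)ᶜ with hU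
  have hUo : IsOpen U := QuotientAddGroup.isOpenMap_coe _ (isClosed_goodSet b ε R).isOpen_compl
  have hpre : QuotientAddGroup.mk ⁻¹' U = (goodSet b ε R)ᶜ := by
    ext x
    constructor
    · rintro ⟨y, hy, hyx⟩ hx
      obtain ⟨t, ht⟩ := (AddCircle.coe_eq_zero_iff (1 : ℝ)).mp
        ((AddCircle.coe_sub (1 : ℝ) (x := y) (y := x)).trans (sub_eq_zero.mpr hyx))
      refine hy ?_
      have : y = x + t := by
        rw [zsmul_eq_mul, mul_one] at ht; linarith
      rw [this]
      exact (add_intCast_mem_goodSet t).mpr hx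
    · exact fun hx => ⟨x, hx, rfl⟩
  have h1 := AddCircle.add_projection_respects_measure 1 t hUo.measurableSet
  have h2 := AddCircle.add_projection_respects_measure 1 0 hUo.measurableSet
  rw [hpre] at h1 h2
  rw [← h1, h2, zero_add]

/-- In every interval, most points have a base-`b` orbit which is well distributed from the time
at which the interval stops determining the digits; the precision is uniform in the interval. -/
lemma exists_forall_volume_compl_le {b : ℕ} (hb : 2 ≤ b) {ε : ℝ} (hε : 0 < ε) :
    ∃ R : ℝ, 0 ≤ R ∧ ∀ α l : ℝ, 0 < l → l ≤ 1 →
      MeasureTheory.volume {x ∈ Ioc α (α + l) | (b : ℝ) ^ scale b l * x ∉ goodSet b ε R} ≤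
        ENNReal.ofReal (l / 8) := by
  have hb0 : (0 : ℝ) < b := by positivity
  obtain ⟨R, hR, hvol⟩ := exists_measure_compl_goodSet_lt hb hε
    (show 0 < 1 / (8 * (b : ℝ)) by positivity)
  refine ⟨R, hR, fun α l hl hl1 => ?_⟩
  set B : ℝ := (b : ℝ) ^ scale b l with hB
  have hB0 : 0 < B := by positivity
  have h1 : B * l ≤ 1 := pow_scale_mul_le hl hl1
  have h2 : 1 < B * b * l := by
    have := lt_pow_scale_succ_mul hb hl
    rwa [pow_succ] at this
  calc _ ≤ MeasureTheory.volume
        ((fun x => B * x) ⁻¹' ((goodSet b ε R)ᶜ ∩ Ioc (B * α) (B * α + 1))) := by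
        refine MeasureTheory.measure_mono fun x hx => ⟨hx.2, ?_, ?_⟩
        · exact mul_lt_mul_of_pos_left hx.1.1 hB0
        · have := mul_le_mul_of_nonneg_left hx.1.2 hB0.le
          simp only; linarith
    _ = ENNReal.ofReal |B⁻¹| * MeasureTheory.volume ((goodSet b ε R)ᶜ ∩ Ioc 0 1) := by
        rw [Real.volume_preimage_mul_left hB0.ne', volume_compl_goodSet_inter_Ioc]
    _ ≤ ENNReal.ofReal |B⁻¹| * ENNReal.ofReal (1 / (8 * (b : ℝ))) := by gcongr
    _ = ENNReal.ofReal (B⁻¹ * (1 / (8 * (b : ℝ)))) := by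
        rw [← ENNReal.ofReal_mul (abs_nonneg _), abs_of_pos (inv_pos.mpr hB0)]
    _ ≤ ENNReal.ofReal (l / 8) := by
        refine ENNReal.ofReal_le_ofReal ?_
        rw [inv_mul_le_iff₀ hB0, div_le_iff₀ (by positivity)]
        linarith

lemma volume_le_card_cells {M : ℕ} (hM : 0 < M) {S : Set ℝ} (hS : S ⊆ Ioc 0 1) (A : Finset ℕ)
    (hA : ∀ a < M, (Ioc ((a : ℝ) / M) ((a + 1) / M) ∩ S).Nonempty → a ∈ A) :
    MeasureTheory.volume S ≤ ENNReal.ofReal (A.card / M) := by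
  have hM0 : (0 : ℝ) < M := by exact_mod_cast hM
  calc _ ≤ MeasureTheory.volume (⋃ a ∈ A, Ioc ((a : ℝ) / M) ((a + 1) / M)) := by
        refine MeasureTheory.measure_mono fun x hx => ?_
        have hx0 := hS hx
        have hc : 0 < ⌈x * M⌉₊ := Nat.ceil_pos.mpr (mul_pos hx0.1 hM0)
        have hc1 : ⌈x * M⌉₊ ≤ M := Nat.ceil_le.mpr (mul_le_of_le_one_left hM0.le hx0.2)
        have hx1 : x ∈ Ioc (((⌈x * M⌉₊ - 1 : ℕ) : ℝ) / M) (((⌈x * M⌉₊ - 1 : ℕ) + 1) / M) := by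
          rw [mem_Ioc, div_lt_iff₀ hM0, le_div_iff₀ hM0]
          refine ⟨Nat.lt_ceil.mp (by lia), ?_⟩
          have := Nat.le_ceil (x * M)
          rw [Nat.cast_sub hc]; push_cast; linarith
        exact mem_biUnion (hA _ (by lia) ⟨x, hx1, hx⟩) hx1
    _ ≤ ∑ a ∈ A, MeasureTheory.volume (Ioc ((a : ℝ) / M) ((a + 1) / M)) :=
        MeasureTheory.measure_biUnion_finset_le _ _
    _ = ENNReal.ofReal (A.card / M) := by
        simp only [Real.volume_Ioc, ← sub_div, add_sub_cancel_left]
        rw [Finset.sum_const, ← ENNReal.ofReal_nsmul, nsmul_eq_mul]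
        congr 1; ring

/-- Multiplication by a unit `u` permutes the residues modulo `M`, so two sets of total measure
more than `1` meet the cells of some residue `a` and of its multiple `u * a`. -/
lemma exists_cell {M u : ℕ} (hM : 0 < M) (hu : Nat.Coprime u M) {S E : Set ℝ}
    (hS : S ⊆ Ioc 0 1) (hE : E ⊆ Ioc 0 1)
    (h : 1 < MeasureTheory.volume S + MeasureTheory.volume E) :
    ∃ a < M, (Ioc ((a : ℝ) / M) ((a + 1) / M) ∩ S).Nonempty ∧
      (Ioc (((u * a % M : ℕ) : ℝ) / M) (((u * a % M : ℕ) + 1) / M) ∩ E).Nonempty := by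
  classical
  have hM0 : (0 : ℝ) < M := by exact_mod_cast hM
  by_contra! hcon
  set A := (Finset.range M).filter fun a : ℕ =>
    (Ioc ((a : ℝ) / M) ((a + 1) / M) ∩ S).Nonempty with hA
  set B := (Finset.range M).filter fun a : ℕ =>
    (Ioc ((a : ℝ) / M) ((a + 1) / M) ∩ E).Nonempty with hB
  set C := {a ∈ Finset.range M | u * a % M ∈ B} with hC
  have h1 := volume_le_card_cells hM hS A fun a ha hne =>
    Finset.mem_filter.mpr ⟨Finset.mem_range.mpr ha, hne⟩
  have h2 := volume_le_card_cells hM hE B fun a ha hne =>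
    Finset.mem_filter.mpr ⟨Finset.mem_range.mpr ha, hne⟩
  have hinj : Set.InjOn (fun a => u * a % M) (Finset.range M) := by
    intro a ha a' ha' haa'
    have h3 : a ≡ a' [MOD M] := Nat.ModEq.cancel_left_of_coprime
      (by rw [Nat.gcd_comm]; exact hu) haa'
    exact Nat.ModEq.eq_of_lt_of_lt h3 (by simpa using ha) (by simpa using ha')
  have himage : (Finset.range M).image (fun a => u * a % M) = Finset.range M := by
    refine Finset.eq_of_subset_of_card_le (fun v hv => ?_) ?_
    · obtain ⟨a, -, rfl⟩ := Finset.mem_image.mp hv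
      exact Finset.mem_range.mpr (Nat.mod_lt _ hM)
    · rw [Finset.card_image_of_injOn hinj]
  have hBC : B.card ≤ C.card := by
    refine (Finset.card_le_card (t := C.image fun a => u * a % M) fun v hv => ?_).trans
      Finset.card_image_le
    have hv' : v ∈ (Finset.range M).image (fun a => u * a % M) := by
      rw [himage]; exact (Finset.mem_filter.mp hv).1
    obtain ⟨a, ha, rfl⟩ := Finset.mem_image.mp hv'
    exact Finset.mem_image.mpr ⟨a, Finset.mem_filter.mpr ⟨ha, hv⟩, rfl⟩
  have hdisj : Disjoint A C := by
    rw [Finset.disjoint_left]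
    intro a ha hac
    have ha' := Finset.mem_filter.mp ha
    have h3 := hcon a (Finset.mem_range.mp ha'.1) ha'.2
    exact (Finset.mem_filter.mp (Finset.mem_filter.mp hac).2).2.ne_empty h3
  have hcard : A.card + B.card ≤ M := by
    have h3 : (A ∪ C).card ≤ (Finset.range M).card :=
      Finset.card_le_card (Finset.union_subset (Finset.filter_subset _ _) (Finset.filter_subset _ _))
    rw [Finset.card_union_of_disjoint hdisj, Finset.card_range] at h3
    lia
  refine absurd (h.trans_le (add_le_add h1 h2)) (not_lt.mpr ?_)
  rw [← ENNReal.ofReal_add (by positivity) (by positivity), ← add_div, ENNReal.ofReal_le_one,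
    div_le_one hM0]
  exact_mod_cast hcard

/-- Comparison of the exponential sums at `y` with those of a nearby point `x` whose orbit is well
distributed from time `q` on. -/
lemma weylSum_le_of_mem_goodSet {g : ℕ} (hg : 2 ≤ g) {ε R x y : ℝ} (hε : 0 ≤ ε) {q n : ℕ}
    (hx : (g : ℝ) ^ q * x ∈ goodSet g ε R) (hqn : q ≤ n) (hxy : (g : ℝ) ^ n * |x - y| ≤ 1) :
    weylSum g n y ≤ weylSum g q y + ε * n + (R + 26) := by
  have hg1 : (1 : ℝ) ≤ g := by exact_mod_cast (by lia : 1 ≤ g)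
  have hxq : (g : ℝ) ^ q * |x - y| ≤ 1 :=
    (mul_le_mul_of_nonneg_right (pow_le_pow_right₀ hg1 hqn) (abs_nonneg _)).trans hxy
  have h1 := weylSum_le_add hg (by rwa [abs_sub_comm] at hxy : (g : ℝ) ^ n * |y - x| ≤ 1)
  have h2 := weylSum_le_add hg hxq
  have h3 := weylSum_add_le g q (n - q) x
  rw [Nat.add_sub_cancel' hqn] at h3
  have h4 := hx (n - q)
  have h5 : ε * (n - q : ℕ) ≤ ε * n :=
    mul_le_mul_of_nonneg_left (by exact_mod_cast Nat.sub_le n q) hε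
  linarith

/-- The basic step of the construction. Every interval contains a `c`-adic interval all of whose
points have a run of `p / m` zeros among their base-`c` digits, from position `p` on, whereas
their base-`b` digits stay well distributed throughout, and their base-`c` digits do so up to
position `p`. The error term `R` does not depend on the interval. -/
lemma exists_step {b c : ℕ} (hb : 2 ≤ b) (hc : 2 ≤ c) (hbc : Nat.Coprime b c) {ε : ℝ}
    (hε : 0 < ε) :
    ∃ R : ℝ, ∀ α l : ℝ, 0 ≤ α → 0 < l → α + l ≤ 1 → ∀ m P : ℕ, ∃ p a : ℕ, P ≤ p ∧
      α < a / (c : ℝ) ^ p ∧ a / (c : ℝ) ^ p + 1 / (c : ℝ) ^ (p + p / m) < α + l ∧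
      ∀ y ∈ Icc (a / (c : ℝ) ^ p) (a / (c : ℝ) ^ p + 1 / (c : ℝ) ^ (p + p / m)),
        (∀ n, scale b l ≤ n → (b : ℝ) ^ n * (1 / (c : ℝ) ^ (p + p / m)) ≤ 1 →
          weylSum b n y ≤ weylSum b (scale b l) y + 2 * ε * n + R) ∧
        (∀ n, scale c l ≤ n → n ≤ p →
          weylSum c n y ≤ weylSum c (scale c l) y + ε * n + R) := by
  obtain ⟨Rb, hRb, hvb⟩ := exists_forall_volume_compl_le hb hε
  obtain ⟨Rc, hRc, hvc⟩ := exists_forall_volume_compl_le hc hε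
  refine ⟨Rb + Rc + 39 + 13 * b, fun α l hα hl hαl m P => ?_⟩
  have hl1 : l ≤ 1 := by linarith
  have hb1 : (1 : ℝ) < b := by exact_mod_cast hb
  have hc1 : (1 : ℝ) < c := by exact_mod_cast hc
  obtain ⟨R', hR', hv'⟩ := exists_measure_compl_goodSet_lt hb hε
    (show 0 < l / 8 by positivity)
  set S : Set ℝ := {x ∈ Ioc (α + l / 4) (α + l / 4 + l / 2) |
    (b : ℝ) ^ scale b l * x ∈ goodSet b ε Rb ∧ (c : ℝ) ^ scale c l * x ∈ goodSet c ε Rc} with hS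
  have hS01 : S ⊆ Ioc 0 1 := fun x hx => ⟨by linarith [hx.1.1], by linarith [hx.1.2]⟩
  have hSvol : ENNReal.ofReal (l / 4) ≤ MeasureTheory.volume S := by
    have h1 : Ioc (α + l / 4) (α + l / 4 + l / 2) ⊆
        S ∪ ({x ∈ Ioc α (α + l) | (b : ℝ) ^ scale b l * x ∉ goodSet b ε Rb} ∪
          {x ∈ Ioc α (α + l) | (c : ℝ) ^ scale c l * x ∉ goodSet c ε Rc}) := by
      intro x hx
      have hx' : x ∈ Ioc α (α + l) := ⟨by linarith [hx.1], by linarith [hx.2]⟩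
      by_cases h1 : (b : ℝ) ^ scale b l * x ∈ goodSet b ε Rb
      · by_cases h2 : (c : ℝ) ^ scale c l * x ∈ goodSet c ε Rc
        · exact Or.inl ⟨hx, h1, h2⟩
        · exact Or.inr (Or.inr ⟨hx', h2⟩)
      · exact Or.inr (Or.inl ⟨hx', h1⟩)
    have h2 := (MeasureTheory.measure_mono (μ := MeasureTheory.volume) h1).trans
      ((MeasureTheory.measure_union_le _ _).trans (add_le_add le_rfl
        ((MeasureTheory.measure_union_le _ _).trans
          (add_le_add (hvb α l hl hl1) (hvc α l hl hl1)))))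
    rw [Real.volume_Ioc, ← ENNReal.ofReal_add (by positivity) (by positivity)] at h2
    have h3 : α + l / 4 + l / 2 - (α + l / 4) = l / 4 + (l / 8 + l / 8) := by ring
    rw [h3, ENNReal.ofReal_add (by positivity) (by positivity)] at h2
    exact ENNReal.le_of_add_le_add_right ENNReal.ofReal_ne_top h2
  set E : Set ℝ := goodSet b ε R' ∩ Ioc 0 1 with hE
  have hEvol : 1 ≤ MeasureTheory.volume E + ENNReal.ofReal (l / 8) := by
    have h1 : Ioc (0 : ℝ) 1 ⊆ E ∪ ((goodSet b ε R')ᶜ ∩ Ioc 0 1) := fun x hx => by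
      by_cases h : x ∈ goodSet b ε R'
      · exact Or.inl ⟨h, hx⟩
      · exact Or.inr ⟨h, hx⟩
    have h2 := (MeasureTheory.measure_mono (μ := MeasureTheory.volume) h1).trans
      ((MeasureTheory.measure_union_le _ _).trans (add_le_add le_rfl hv'.le))
    rwa [Real.volume_Ioc, sub_zero, ENNReal.ofReal_one] at h2
  have hSE : 1 < MeasureTheory.volume S + MeasureTheory.volume E := by
    have h1 : MeasureTheory.volume E ≠ ⊤ :=
      ((MeasureTheory.measure_mono inter_subset_right).trans_lt (by simp)).ne
    refine hEvol.trans_lt ?_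
    rw [add_comm]
    refine ENNReal.add_lt_add_right h1 (lt_of_lt_of_le ?_ hSvol)
    exact (ENNReal.ofReal_lt_ofReal_iff (by positivity)).mpr (by linarith)
  -- a large enough level `p`: the additive error `R'` is absorbed by `ε * log_b (c ^ p)`
  obtain ⟨N, hN⟩ := exists_nat_ge (R' / ε)
  obtain ⟨p, ⟨hp1, hp2⟩, hpP⟩ := (((tendsto_pow_atTop_atTop_of_one_lt hc1).eventually_ge_atTop
    ((b : ℝ) ^ N)).and ((tendsto_pow_atTop_atTop_of_one_lt hc1).eventually_ge_atTop
    (4 / l)) |>.and (eventually_ge_atTop P)).exists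
  set n₁ := Nat.log b (c ^ p) with hn₁
  have hcp0 : 0 < c ^ p := by positivity
  have hM0 : (0 : ℝ) < (c : ℝ) ^ p := by positivity
  have hn₁le : (b : ℝ) ^ n₁ ≤ (c : ℝ) ^ p := by
    exact_mod_cast Nat.pow_log_le_self b hcp0.ne'
  have hn₁lt : (c : ℝ) ^ p < (b : ℝ) ^ n₁ * b := by
    rw [← pow_succ]; exact_mod_cast Nat.lt_pow_succ_log_self hb (c ^ p)
  have hR'n : R' ≤ ε * n₁ := by
    have h1 : N ≤ n₁ := Nat.le_log_of_pow_le hb (by exact_mod_cast hp1)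
    have h2 : (N : ℝ) ≤ n₁ := by exact_mod_cast h1
    rw [div_le_iff₀ hε] at hN
    nlinarith
  have hcl : 1 / (c : ℝ) ^ p ≤ l / 4 := by
    rw [div_le_iff₀ hl] at hp2
    rw [div_le_iff₀ hM0]; linarith
  obtain ⟨a, -, ⟨x, hxa, hxS⟩, ⟨U, hUv, hUE⟩⟩ := exists_cell hcp0
    (Nat.Coprime.pow n₁ p hbc) hS01 (inter_subset_right : E ⊆ _) hSE
  set v := b ^ n₁ * a % c ^ p with hv
  push_cast at hxa hUv
  rw [add_div] at hxa hUv
  have hl' : 1 / (c : ℝ) ^ (p + p / m) ≤ 1 / (c : ℝ) ^ p :=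
    one_div_le_one_div_of_le hM0 (pow_le_pow_right₀ hc1.le (Nat.le_add_right _ _))
  refine ⟨p, a, hpP, ?_, ?_, fun y hy => ?_⟩
  · linarith [hxa.2, hxS.1.1]
  · linarith [hxa.1, hxS.1.2]
  have hxy : |x - y| ≤ 1 / (c : ℝ) ^ p := by
    rw [abs_le]
    exact ⟨by linarith [hxa.1, hy.2], by linarith [hxa.2, hy.1]⟩
  have hclose : ∀ g n : ℕ, (g : ℝ) ^ n ≤ (c : ℝ) ^ p → (g : ℝ) ^ n * |x - y| ≤ 1 := by
    intro g n hgn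
    calc (g : ℝ) ^ n * |x - y| ≤ (c : ℝ) ^ p * (1 / (c : ℝ) ^ p) := by gcongr
      _ = 1 := mul_one_div_cancel hM0.ne'
  have hb0 : (0 : ℝ) ≤ b := by positivity
  refine ⟨fun n hqn hn => ?_, fun n hqn hnp => ?_⟩
  swap
  · have h1 := weylSum_le_of_mem_goodSet hc hε.le hxS.2.2 hqn
      (hclose c n (pow_le_pow_right₀ hc1.le hnp))
    linarith
  have hεn : 0 ≤ ε * n := by positivity
  rcases le_or_gt n n₁ with hnn₁ | hnn₁
  · have h1 := weylSum_le_of_mem_goodSet hb hε.le hxS.2.1 hqn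
      (hclose b n ((pow_le_pow_right₀ hb1.le hnn₁).trans hn₁le))
    linarith
  -- from time `n₁` on, the orbit of `y` shadows that of `v / c ^ p`, hence that of `U`
  have hq₁ : scale b l ≤ n₁ := by
    refine Nat.le_log_of_pow_le hb ?_
    have h1 := pow_scale_mul_le (g := b) hl hl1
    have h2 : (b : ℝ) ^ scale b l ≤ (c : ℝ) ^ p := by
      rw [← le_div_iff₀ hl] at h1
      refine h1.trans (le_trans ?_ hp2)
      gcongr; norm_num
    exact_mod_cast h2
  have h1 := weylSum_le_of_mem_goodSet hb hε.le hxS.2.1 hq₁ (hclose b n₁ hn₁le)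
  have h2 := weylSum_add_le b n₁ (n - n₁) y
  rw [Nat.add_sub_cancel' hnn₁.le] at h2
  have hpow : (b : ℝ) ^ (n - n₁) * (b : ℝ) ^ n₁ = (b : ℝ) ^ n := by
    rw [← pow_add, Nat.sub_add_cancel hnn₁.le]
  have h3 : weylSum b (n - n₁) ((b : ℝ) ^ n₁ * y) ≤
      weylSum b (n - n₁) ((b : ℝ) ^ n₁ * (a / (c : ℝ) ^ p)) + 13 * 1 := by
    refine weylSum_le_add hb (le_trans ?_ hn)
    rw [← mul_sub, abs_mul, abs_of_pos (by positivity : (0 : ℝ) < (b : ℝ) ^ n₁), ← mul_assoc, hpow]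
    refine mul_le_mul_of_nonneg_left ?_ (by positivity)
    rw [abs_of_nonneg (by linarith [hy.1])]
    linarith [hy.2]
  have h4 : (b : ℝ) ^ n₁ * (a / (c : ℝ) ^ p) =
      (v : ℝ) / (c : ℝ) ^ p + ((b ^ n₁ * a / c ^ p : ℕ) : ℤ) := by
    have h5 : ((b ^ n₁ * a : ℕ) : ℝ) = ((v + c ^ p * (b ^ n₁ * a / c ^ p) : ℕ) : ℝ) := by
      rw [hv, Nat.mod_add_div]
    push_cast at h5
    rw [← mul_div_assoc, h5, Int.cast_natCast]
    field_simp
  rw [h4, weylSum_add_intCast] at h3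
  have h5 : weylSum b (n - n₁) ((v : ℝ) / (c : ℝ) ^ p) ≤ weylSum b (n - n₁) U + 13 * b := by
    refine weylSum_le_add hb ?_
    have h6 : |(v : ℝ) / (c : ℝ) ^ p - U| ≤ 1 / (c : ℝ) ^ p := by
      rw [abs_le]; exact ⟨by linarith [hUv.2], by linarith [hUv.1, one_div_pos.mpr hM0]⟩
    have h7 : (b : ℝ) ^ n ≤ (c : ℝ) ^ p * (c : ℝ) ^ p := by
      rw [mul_one_div, div_le_one (by positivity)] at hn
      refine hn.trans ?_
      rw [← pow_add]
      exact pow_le_pow_right₀ hc1.le (by have := Nat.div_le_self p m; lia)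
    have h8 : (b : ℝ) ^ (n - n₁) ≤ b * (c : ℝ) ^ p := by
      have hbn : (0 : ℝ) < (b : ℝ) ^ n₁ := by positivity
      refine le_of_mul_le_mul_right ?_ hbn
      rw [hpow]
      calc (b : ℝ) ^ n ≤ (c : ℝ) ^ p * (c : ℝ) ^ p := h7
        _ ≤ (c : ℝ) ^ p * ((b : ℝ) ^ n₁ * b) := by gcongr
        _ = _ := by ring
    calc _ ≤ b * (c : ℝ) ^ p * (1 / (c : ℝ) ^ p) := by gcongr
      _ = b := by field_simp
  have h6 := hUE.1 (n - n₁)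
  rw [Nat.cast_sub hnn₁.le] at h6
  have h7 : ε * n₁ ≤ ε * n := mul_le_mul_of_nonneg_left (by exact_mod_cast hnn₁.le) hε.le
  linarith

/-! ### Runs of zeros -/

lemma digits_eq_zero_of_mem_Ico {c : ℕ} [NeZero c] {p q a : ℕ} {y : ℝ}
    (hy : y ∈ Ico (a / (c : ℝ) ^ p) (a / (c : ℝ) ^ p + 1 / (c : ℝ) ^ q)) {i : ℕ}
    (hpi : p ≤ i) (hiq : i < q) : Real.digits y c i = 0 := by
  have hc : (0 : ℝ) < c := by exact_mod_cast NeZero.pos c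
  have hc1 : (1 : ℝ) ≤ c := by exact_mod_cast NeZero.pos c
  have h1 : ⌊y * (c : ℝ) ^ (i + 1)⌋₊ = a * c ^ (i - p) * c := by
    have h2 : (a / (c : ℝ) ^ p) * (c : ℝ) ^ (i + 1) = a * (c : ℝ) ^ (i - p) * c := by
      have : i + 1 = p + (i - p) + 1 := by lia
      rw [this, pow_add, pow_add]; field_simp
    rw [Nat.floor_eq_iff (mul_nonneg (le_trans (by positivity) hy.1) (by positivity))]
    push_cast
    rw [← h2]
    refine ⟨mul_le_mul_of_nonneg_right hy.1 (by positivity), ?_⟩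
    calc y * (c : ℝ) ^ (i + 1)
        < (a / (c : ℝ) ^ p + 1 / (c : ℝ) ^ q) * (c : ℝ) ^ (i + 1) :=
          mul_lt_mul_of_pos_right hy.2 (by positivity)
      _ ≤ _ := by
          rw [add_mul, one_div_mul_eq_div]
          gcongr
          rw [div_le_one (by positivity)]
          exact pow_le_pow_right₀ hc1 hiq
  rw [Real.digits, h1]
  apply Fin.ext
  rw [Fin.val_ofNat, Nat.mul_mod_left]
  rfl

/-- A number with zero digits on infinitely many blocks `[p, p + p / M)` is not normal: the
frequency of the digit zero would jump from the beginning to the end of such a block. -/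
lemma notMem_normalNumbers_of_runs {c M : ℕ} [NeZero c] (hc : 2 ≤ c) (hM : 0 < M) {y : ℝ}
    (h : ∀ N : ℕ, ∃ p ≥ N, ∀ i, p ≤ i → i < p + p / M → Real.digits y c i = 0) :
    y ∉ normalNumbers c := by
  intro hy
  have hlim := hy.2 1 (fun _ => 0)
  rw [pow_one] at hlim
  set f : ℕ → ℕ := fun n => wordCount y (fun _ : Fin 1 => (0 : Fin c)) n with hf
  have hfi : ∀ n, f n = {i ∈ Finset.range n | Real.digits y c i = 0}.card := by
    intro n
    simp only [hf, wordCount]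
    congr 1
    ext i
    simp only [Finset.mem_filter, Finset.mem_range]
    constructor
    · rintro ⟨h1, -, h2⟩
      exact ⟨h1, by simpa using h2 0⟩
    · rintro ⟨h1, h2⟩
      exact ⟨h1, h1, fun j => by simpa using h2⟩
  have hM0 : (0 : ℝ) < M := by exact_mod_cast hM
  obtain ⟨N, hN⟩ := Metric.tendsto_atTop.mp hlim (1 / (16 * (M : ℝ))) (by positivity)
  obtain ⟨p, hpN, hrun⟩ := h (N + M)
  set L := p / M with hL
  have hL1 : 1 ≤ L := (Nat.one_le_div_iff hM).mpr (by lia)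
  have hpL : (p : ℝ) ≤ 2 * M * L := by
    have h1 : p < M * (L + 1) := Nat.lt_mul_div_succ p hM
    have h2 : M * 1 ≤ M * L := Nat.mul_le_mul_left M hL1
    have h3 : p ≤ 2 * M * L := by nlinarith
    exact_mod_cast h3
  have hfp : f p + L ≤ f (p + L) := by
    rw [hfi, hfi]
    have h1 : {i ∈ Finset.range p | Real.digits y c i = 0} ∪ Finset.Ico p (p + L) ⊆
        {i ∈ Finset.range (p + L) | Real.digits y c i = 0} := by
      intro i hi
      simp only [Finset.mem_union, Finset.mem_filter, Finset.mem_range, Finset.mem_Ico] at hi ⊢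
      rcases hi with ⟨h1, h2⟩ | ⟨h1, h2⟩
      · exact ⟨by lia, h2⟩
      · exact ⟨h2, hrun i h1 h2⟩
    have h2 := Finset.card_le_card h1
    rw [Finset.card_union_of_disjoint] at h2
    · simpa using h2
    · rw [Finset.disjoint_left]
      intro i hi hi'
      simp only [Finset.mem_filter, Finset.mem_range, Finset.mem_Ico] at hi hi'
      lia
  have hfpR : (f p : ℝ) + L ≤ f (p + L) := by exact_mod_cast hfp
  have hp0 : (0 : ℝ) < p := by
    have : 0 < p := by lia
    exact_mod_cast this
  have hLR : (1 : ℝ) ≤ L := by exact_mod_cast hL1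
  have h1 := (abs_lt.mp (hN p (by lia))).1
  have h2 := (abs_lt.mp (hN (p + L) (by lia))).2
  change -(1 / (16 * (M : ℝ))) < (f p : ℝ) / p - 1 / c at h1
  change (f (p + L) : ℝ) / (p + L : ℕ) - 1 / c < 1 / (16 * (M : ℝ)) at h2
  push_cast at h2
  have h1' : (1 / c - 1 / (16 * (M : ℝ))) * p < f p := by
    rw [← lt_div_iff₀ hp0]; linarith
  have h2' : (f (p + L) : ℝ) < (1 / c + 1 / (16 * (M : ℝ))) * (p + L) := by
    rw [← div_lt_iff₀ (by positivity)]; linarith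
  have hc2 : (1 : ℝ) / c ≤ 1 / 2 :=
    one_div_le_one_div_of_le two_pos (by exact_mod_cast hc)
  have hM1 : 1 / (16 * (M : ℝ)) * p ≤ L / 8 := by
    rw [one_div_mul_eq_div, div_le_iff₀ (by positivity)]; linarith
  have hM2 : 1 / (16 * (M : ℝ)) ≤ 1 / 16 := by
    have : (1 : ℝ) ≤ M := by exact_mod_cast hM
    exact one_div_le_one_div_of_le (by norm_num) (by linarith)
  have h3 : (1 : ℝ) / c * L ≤ 1 / 2 * L := by gcongr
  have h4 : 1 / (16 * (M : ℝ)) * L ≤ 1 / 16 * L := by gcongr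
  linarith

/-! ### The nested intervals -/

/-- The requirements on two consecutive intervals `[I.1, I.1 + I.2]` and `[J.1, J.1 + J.2]` of the
construction. The base receiving the run of zeros at stage `i` is `g i.bodd`; the relative length
of the run is `1 / m`. The numbers `R i` are the error terms of the successive stages. The last
interval must be so short that the digits it determines dwarf those determined by the previous one
and the error term of the next stage. -/
structure IsStage (g : Bool → ℕ) [∀ β, NeZero (g β)] (R : ℕ → ℝ) (i m : ℕ) (I J : ℝ × ℝ) :
    Prop where
  lt_left : I.1 < J.1
  pos : 0 < J.2
  right_lt : J.1 + J.2 < I.1 + I.2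
  le_scale : ∀ β, i ≤ scale (g β) J.2
  mul_scale_le : ∀ β, ((i + 1 : ℕ) : ℝ) * scale (g β) I.2 ≤ scale (g β) J.2
  error_le : ∀ β, ((i + 2 : ℕ) : ℝ) * R (i + 1) ≤ scale (g β) J.2
  weylSum_le : ∀ y ∈ Icc J.1 (J.1 + J.2), ∀ β n, scale (g β) I.2 ≤ n → n ≤ scale (g β) J.2 →
    weylSum (g β) n y ≤ weylSum (g β) (scale (g β) I.2) y + 2 * (1 / ((i + 1 : ℕ) : ℝ)) * n + R i +
      if i.bodd = β then (n : ℝ) / m else 0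
  exists_run : ∃ p ≥ i, ∀ y ∈ Ico J.1 (J.1 + J.2), ∀ j, p ≤ j → j < p + p / m →
    Real.digits y (g i.bodd) j = 0

lemma exists_isStage (g : Bool → ℕ) [∀ β, NeZero (g β)] (hg : ∀ β, 2 ≤ g β)
    (hco : Nat.Coprime (g true) (g false)) :
    ∃ R : ℕ → ℝ, ∀ i m : ℕ, ∀ I : ℝ × ℝ, 0 ≤ I.1 → 0 < I.2 → I.1 + I.2 ≤ 1 →
      ∃ J, IsStage g R i m I J := by
  have hco' : ∀ β, Nat.Coprime (g !β) (g β) := by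
    intro β
    cases β
    · exact hco
    · exact hco.symm
  choose R hR using fun i : ℕ => exists_step (hg (!i.bodd)) (hg i.bodd) (hco' i.bodd)
    (show (0 : ℝ) < 1 / ((i + 1 : ℕ) : ℝ) by positivity)
  refine ⟨R, fun i m ⟨α, l⟩ hα hl hαl => ?_⟩
  simp only at hα hl hαl
  set β₀ := i.bodd with hβ₀
  -- the number of digits the new interval has to determine
  obtain ⟨K, hK⟩ : ∃ K : ℕ, K = i + (i + 1) * (scale (g true) l + scale (g false) l) +
    ⌈((i + 2 : ℕ) : ℝ) * R (i + 1)⌉₊ := ⟨_, rfl⟩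
  obtain ⟨p, a, hp, h1, h2, h3⟩ := hR i α l hα hl hαl m
    (scale (g β₀) l + (g true) ^ K + (g false) ^ K)
  set L := p / m with hL
  have hc1 : (1 : ℝ) < g β₀ := by exact_mod_cast hg β₀
  have hcp : (0 : ℝ) < (g β₀ : ℝ) ^ (p + L) := by positivity
  have hJ2 : 0 < 1 / (g β₀ : ℝ) ^ (p + L) := by positivity
  have hKscale : ∀ β, K ≤ scale (g β) (1 / (g β₀ : ℝ) ^ (p + L)) := by
    intro β
    refine _root_.le_scale (hg β) hJ2 ?_
    rw [mul_one_div, div_le_one hcp]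
    have h4 : (g β) ^ K ≤ p := by
      cases β <;> lia
    have h5 : p ≤ (g β₀) ^ (p + L) := by
      refine (Nat.lt_pow_self (hg β₀)).le.trans ?_
      exact Nat.pow_le_pow_right (by have := hg β₀; lia) (Nat.le_add_right p L)
    exact_mod_cast h4.trans h5
  have hscale0 : scale (g β₀) (1 / (g β₀ : ℝ) ^ (p + L)) ≤ p + L := by
    have h4 := pow_scale_mul_le (g := g β₀) hJ2 (by
      rw [div_le_one hcp]; exact one_le_pow₀ hc1.le)
    rw [mul_one_div, div_le_one hcp] at h4
    exact (pow_le_pow_iff_right₀ hc1).mp h4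
  refine ⟨(a / (g β₀ : ℝ) ^ p, 1 / (g β₀ : ℝ) ^ (p + L)), h1, hJ2, h2, fun β => ?_, fun β => ?_,
    fun β => ?_, fun y hy β n hn hn' => ?_, ?_⟩
  · exact le_trans (by lia) (hKscale β)
  · have h4 : (i + 1) * scale (g β) l ≤ K := by
      cases β <;> simp only [hK, mul_add] <;> lia
    exact_mod_cast h4.trans (hKscale β)
  · refine (Nat.le_ceil _).trans ?_
    exact_mod_cast le_trans (by lia) (hKscale β)
  · obtain ⟨hb, hc⟩ := h3 y hy
    simp only at hn hn' ⊢
    have hε : (0 : ℝ) ≤ 1 / ((i + 1 : ℕ) : ℝ) := by positivity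
    by_cases hβ : β₀ = β
    · subst hβ
      rw [if_pos rfl]
      rcases le_or_gt n p with hnp | hnp
      · have h4 := hc n hn hnp
        have h5 : (0 : ℝ) ≤ n / m := by positivity
        have h6 : 0 ≤ 1 / ((i + 1 : ℕ) : ℝ) * n := by positivity
        linarith
      · -- within the run of zeros only the trivial bound is available
        have h4 := hc p (by lia) le_rfl
        have h5 := weylSum_add_le (g β₀) p (n - p) y
        rw [Nat.add_sub_cancel' hnp.le] at h5
        have h6 := weylSum_le (g β₀) (n - p) ((g β₀ : ℝ) ^ p * y)
        have h7 : ((n - p : ℕ) : ℝ) ≤ n / m := by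
          calc ((n - p : ℕ) : ℝ) ≤ (L : ℝ) := by
                have : n - p ≤ L := by lia
                exact_mod_cast this
            _ ≤ (p : ℝ) / m := Nat.cast_div_le
            _ ≤ n / m := by gcongr
        have h8 : 1 / ((i + 1 : ℕ) : ℝ) * p ≤ 1 / ((i + 1 : ℕ) : ℝ) * n := by gcongr
        have h9 : 0 ≤ 1 / ((i + 1 : ℕ) : ℝ) * n := by positivity
        linarith
    · rw [if_neg hβ, add_zero]
      obtain rfl : β = !β₀ := Bool.eq_not_iff.mpr (Ne.symm hβ)
      refine hb n hn ?_
      have h4 := pow_scale_mul_le (g := g (!β₀)) hJ2 (by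
        rw [div_le_one hcp]; exact one_le_pow₀ hc1.le)
      refine le_trans (mul_le_mul_of_nonneg_right ?_ hJ2.le) h4
      exact pow_le_pow_right₀ (by exact_mod_cast (by have := hg (!β₀); lia : 1 ≤ g (!β₀))) hn'
  · refine ⟨p, ?_, fun y hy j hpj hj => digits_eq_zero_of_mem_Ico hy hpj hj⟩
    have : K < (g β₀) ^ K := Nat.lt_pow_self (hg β₀)
    have h4 : (g β₀) ^ K ≤ p := by
      cases hb : β₀ <;> rw [hb] at hp <;> lia
    lia

lemma exists_stages (g : Bool → ℕ) [∀ β, NeZero (g β)] (hg : ∀ β, 2 ≤ g β)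
    (hco : Nat.Coprime (g true) (g false)) :
    ∃ (R : ℕ → ℝ) (I : (ℕ → ℕ) → ℕ → ℝ × ℝ),
      (∀ m m' i, (∀ j < i, m j = m' j) → I m i = I m' i) ∧
      (∀ m, I m 0 = (0, 1 / 2)) ∧ ∀ m i, IsStage g R i (m i) (I m i) (I m (i + 1)) := by
  obtain ⟨R, hR⟩ := exists_isStage g hg hco
  choose! next hnext using hR
  let I : (ℕ → ℕ) → ℕ → ℝ × ℝ := fun m i =>
    Nat.rec (0, 1 / 2) (fun i J => next i (m i) J) i
  have hI : ∀ m i, I m (i + 1) = next i (m i) (I m i) := fun _ _ => rfl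
  have hI0 : ∀ m, I m 0 = (0, 1 / 2) := fun _ => rfl
  have hvalid : ∀ m i, 0 ≤ (I m i).1 ∧ 0 < (I m i).2 ∧ (I m i).1 + (I m i).2 ≤ 1 := by
    intro m i
    induction i with
    | zero => rw [hI0]; norm_num
    | succ i ih =>
      have h := hnext i (m i) (I m i) ih.1 ih.2.1 ih.2.2
      rw [← hI] at h
      exact ⟨ih.1.trans h.lt_left.le, h.pos, h.right_lt.le.trans ih.2.2⟩
  refine ⟨R, I, fun m m' i h => ?_, hI0, fun m i => ?_⟩
  · induction i with
    | zero => rfl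
    | succ i ih => rw [hI, hI, ih fun j hj => h j (by lia), h i (by lia)]
  · obtain ⟨h1, h2, h3⟩ := hvalid m i
    exact hI m i ▸ hnext i (m i) (I m i) h1 h2 h3

/-! ### Normality of the limit point -/

section Stages

variable {g : Bool → ℕ} [∀ β, NeZero (g β)] {R : ℕ → ℝ} {m : ℕ → ℕ} {I : ℕ → ℝ × ℝ}

/-- A point of all intervals is normal to a base if the relative lengths `1 / m i` of the runs of
zeros in that base tend to zero. -/
lemma tendsto_weylSum_of_stages (hI : ∀ i, IsStage g R i (m i) (I i) (I (i + 1))) {y : ℝ}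
    (hy : ∀ i, y ∈ Icc (I i).1 ((I i).1 + (I i).2)) (β : Bool)
    (hm : Tendsto (fun i => if i.bodd = β then (1 : ℝ) / m i else 0) atTop (𝓝 0)) :
    Tendsto (fun n : ℕ => weylSum (g β) n y / n) atTop (𝓝 0) := by
  set W := fun n => weylSum (g β) n y with hW
  set s : ℕ → ℕ := fun i => scale (g β) (I i).2 with hs
  set θ : ℕ → ℝ := fun i => if i.bodd = β then (1 : ℝ) / m i else 0 with hθ
  set ε : ℕ → ℝ := fun i => 1 / ((i + 1 : ℕ) : ℝ) with hε
  have hε0 : ∀ i, 0 < ε i := fun i => by simp only [hε]; positivity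
  have hθ0 : ∀ i, 0 ≤ θ i := fun i => by simp only [hθ]; split_ifs <;> positivity
  have hεlim : Tendsto ε atTop (𝓝 0) := by
    simp only [hε]
    exact (tendsto_add_atTop_iff_nat 1).mpr (tendsto_one_div_atTop_nhds_zero_nat (𝕜 := ℝ))
  -- the first error term is negligible at the beginning of each stage but the first
  have hstep : ∀ i n, s (i + 1) ≤ n → n ≤ s (i + 2) →
      W n ≤ W (s (i + 1)) + (3 * ε (i + 1) + θ (i + 1)) * n := by
    intro i n hn hn'
    have h1 := (hI (i + 1)).weylSum_le y (hy (i + 2)) β n hn hn'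
    have h2 : R (i + 1) ≤ ε (i + 1) * n := by
      have h3 := (hI i).error_le β
      have h4 : ((s (i + 1) : ℕ) : ℝ) ≤ n := by exact_mod_cast hn
      simp only [hε]
      rw [one_div_mul_eq_div, le_div_iff₀ (by positivity), mul_comm]
      exact h3.trans h4
    have h5 : (if (i + 1).bodd = β then (n : ℝ) / m (i + 1) else 0) = θ (i + 1) * n := by
      simp only [hθ]
      split_ifs
      · ring
      · rw [zero_mul]
    rw [h5] at h1
    have h6 : W n ≤ W (s (i + 1)) + 2 * ε (i + 1) * n + R (i + 1) + θ (i + 1) * n := h1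
    linarith
  have hsmul : ∀ i, (s i : ℝ) ≤ ε i * s (i + 1) := by
    intro i
    simp only [hε]
    rw [one_div_mul_eq_div, le_div_iff₀ (by positivity), mul_comm]
    exact (hI i).mul_scale_le β
  have hmono : ∀ i, s i ≤ s (i + 1) := by
    intro i
    have h1 := (hI i).mul_scale_le β
    have h2 : (i + 1) * s i ≤ s (i + 1) := by exact_mod_cast h1
    exact (Nat.le_mul_of_pos_left _ i.succ_pos).trans h2
  have hend : ∀ i, W (s (i + 2)) ≤ (4 * ε (i + 1) + θ (i + 1)) * s (i + 2) := by
    intro i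
    have h1 := hstep i (s (i + 2)) (hmono _) le_rfl
    have h2 : W (s (i + 1)) ≤ s (i + 1) := weylSum_le _ _ _
    have h3 := hsmul (i + 1)
    linarith
  have hbound : ∀ i n, s (i + 2) ≤ n → n ≤ s (i + 3) →
      W n ≤ ((4 * ε (i + 1) + θ (i + 1)) + (3 * ε (i + 2) + θ (i + 2))) * n := by
    intro i n hn hn'
    have h1 := hstep (i + 1) n hn hn'
    have h2 := hend i
    have h3 : (4 * ε (i + 1) + θ (i + 1)) * s (i + 2) ≤ (4 * ε (i + 1) + θ (i + 1)) * n :=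
      mul_le_mul_of_nonneg_left (by exact_mod_cast hn)
        (by linarith [hε0 (i + 1), hθ0 (i + 1)])
    have h4 : W n ≤ W (s (i + 2)) + (3 * ε (i + 2) + θ (i + 2)) * n := h1
    linarith
  have hη : Tendsto (fun i => (4 * ε (i + 1) + θ (i + 1)) + (3 * ε (i + 2) + θ (i + 2)))
      atTop (𝓝 0) := by
    have h1 := ((hεlim.const_mul 4).add hm).comp (tendsto_add_atTop_nat 1)
    have h2 := ((hεlim.const_mul 3).add hm).comp (tendsto_add_atTop_nat 2)
    simpa using h1.add h2
  rw [Metric.tendsto_atTop]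
  intro δ hδ
  obtain ⟨N, hN⟩ := Metric.tendsto_atTop.mp hη (δ / 2) (by positivity)
  have hind : ∀ j, N ≤ j → ∀ n, s (N + 2) ≤ n → n ≤ s (j + 3) → W n ≤ δ / 2 * n := by
    have hN' : ∀ i ≥ N, ∀ n, s (i + 2) ≤ n → n ≤ s (i + 3) → W n ≤ δ / 2 * n := by
      intro i hi n hn hn'
      have h1 := hN i hi
      rw [dist_zero_right, Real.norm_eq_abs] at h1
      exact (hbound i n hn hn').trans
        (mul_le_mul_of_nonneg_right ((le_abs_self _).trans h1.le) (by positivity))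
    intro j hj
    induction j, hj using Nat.le_induction with
    | base => exact hN' N le_rfl
    | succ j hj ih =>
      intro n hn hn'
      rcases le_total n (s (j + 3)) with h | h
      · exact ih n hn h
      · exact hN' (j + 1) (by lia) n h hn'
  refine ⟨s (N + 2) + N + 1, fun n hn => ?_⟩
  have hn0 : (0 : ℝ) < n := by
    have : 0 < n := by lia
    exact_mod_cast this
  have h1 : n ≤ s (n + 3) := le_trans (by lia) ((hI (n + 2)).le_scale β)
  have h2 := hind n (by lia) n (by lia) h1
  rw [dist_zero_right, Real.norm_of_nonneg (div_nonneg (weylSum_nonneg _ _ _) hn0.le),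
    div_lt_iff₀ hn0]
  have h3 : δ / 2 * n < δ * n := mul_lt_mul_of_pos_right (by linarith) hn0
  exact h2.trans_lt h3

/-- A point of all intervals is normal to a base exactly if the parameters `m i` of the stages with
runs of zeros in that base tend to infinity. -/
lemma mem_normalNumbers_iff_of_stages (hg : ∀ β, 2 ≤ g β)
    (hI : ∀ i, IsStage g R i (m i) (I i) (I (i + 1))) (hI0 : I 0 = (0, 1 / 2))
    (hm : ∀ i, 0 < m i) {y : ℝ}
    (hy : ∀ i, y ∈ Icc (I i).1 ((I i).1 + (I i).2)) (β : Bool) :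
    y ∈ normalNumbers (g β) ↔ ∀ M, {i | i.bodd = β ∧ m i ≤ M}.Finite := by
  constructor
  · intro hnormal M
    by_contra hinf
    have hinf : {i | i.bodd = β ∧ m i ≤ M}.Infinite := hinf
    refine notMem_normalNumbers_of_runs (M := M) (hg β) ?_ (fun N => ?_) hnormal
    · obtain ⟨i, -, hi⟩ := hinf.nonempty
      exact (hm i).trans_le hi
    · obtain ⟨i, ⟨hi, hiM⟩, hiN⟩ := hinf.exists_gt N
      obtain ⟨p, hp, hrun⟩ := (hI i).exists_run
      refine ⟨p, by lia, fun j hj hj' => ?_⟩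
      have hyI : y ∈ Ico (I (i + 1)).1 ((I (i + 1)).1 + (I (i + 1)).2) :=
        ⟨(hy (i + 1)).1, (hy (i + 2)).2.trans_lt (hI (i + 1)).right_lt⟩
      have h1 : p / M ≤ p / m i := Nat.div_le_div_left hiM (hm i)
      have h2 := hrun y hyI j hj (by lia)
      subst hi
      exact h2
  · intro hfin
    refine (mem_normalNumbers_iff (hg β)).mpr ⟨?_, tendsto_weylSum_of_stages hI hy β ?_⟩
    · have := hy 0
      rw [hI0] at this
      exact ⟨this.1, by linarith [this.2]⟩
    · rw [Metric.tendsto_atTop]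
      intro δ hδ
      obtain ⟨M, hM⟩ := exists_nat_gt (1 / δ)
      have h1 := (hfin M).compl_mem_cofinite
      rw [Nat.cofinite_eq_atTop] at h1
      obtain ⟨N, hN⟩ := mem_atTop_sets.mp h1
      refine ⟨N, fun i hi => ?_⟩
      have h2 : ¬ (i.bodd = β ∧ m i ≤ M) := hN i hi
      rw [dist_zero_right]
      split_ifs with hβ
      · have h3 : M < m i := not_le.mp fun h => h2 ⟨hβ, h⟩
        have h4 : (M : ℝ) < m i := by exact_mod_cast h3
        have h5 : 0 < 1 / δ := by positivity
        rw [Real.norm_of_nonneg (by positivity), one_div_lt (by linarith) hδ]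
        exact hM.trans h4
      · rw [norm_zero]; exact hδ

lemma exists_mem_stages (hI : ∀ i, IsStage g R i (m i) (I i) (I (i + 1))) (hpos : 0 < (I 0).2) :
    ∃ y, ∀ i, y ∈ Icc (I i).1 ((I i).1 + (I i).2) := by
  have hpos' : ∀ i, 0 < (I i).2 := fun i => by
    cases i with
    | zero => exact hpos
    | succ i => exact (hI i).pos
  have h := Monotone.ciSup_mem_iInter_Icc_of_antitone (f := fun i => (I i).1)
    (g := fun i => (I i).1 + (I i).2)
    (monotone_nat_of_le_succ fun i => (hI i).lt_left.le)
    (antitone_nat_of_succ_le fun i => (hI i).right_lt.le) fun i => by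
      have := hpos' i
      simp only; linarith
  exact ⟨_, fun i => mem_iInter.mp h i⟩

lemma IsStage.snd_le (hg : ∀ β, 2 ≤ g β) {i m : ℕ} {I J : ℝ × ℝ} (h : IsStage g R i m I J)
    (hJ : J.2 ≤ 1) : J.2 ≤ (1 / 2) ^ i := by
  have h1 := pow_scale_mul_le (g := g true) h.pos hJ
  have h2 : (2 : ℝ) ^ i ≤ (g true : ℝ) ^ scale (g true) J.2 := by
    calc (2 : ℝ) ^ i ≤ (g true : ℝ) ^ i := by
          gcongr; exact_mod_cast hg true
      _ ≤ _ := pow_le_pow_right₀ (by exact_mod_cast (by have := hg true; lia : 1 ≤ g true))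
          (h.le_scale true)
  have h3 := (mul_le_mul_of_nonneg_right h2 h.pos.le).trans h1
  rw [one_div_pow, le_div_iff₀ (by positivity)]
  linarith

end Stages

/-! ### Completeness -/

/-- The two sets of normal numbers can be prescribed independently: there is a continuous map from
sequences to reals whose values are normal to base `b` exactly if the odd-indexed terms tend to
infinity, and normal to base `c` exactly if the even-indexed terms do. -/
theorem exists_continuous_mem_normalNumbers_iff {b c : ℕ} [NeZero b] [NeZero c] (hb : 2 ≤ b)
    (hc : 2 ≤ c) (hbc : Nat.Coprime b c) :
    ∃ y : (ℕ → ℕ) → ℝ, Continuous y ∧ ∀ m, (∀ i, 0 < m i) →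
      (y m ∈ normalNumbers b ↔ ∀ M, {i | i.bodd = true ∧ m i ≤ M}.Finite) ∧
      (y m ∈ normalNumbers c ↔ ∀ M, {i | i.bodd = false ∧ m i ≤ M}.Finite) := by
  let g : Bool → ℕ := fun β => bif β then b else c
  have : ∀ β, NeZero (g β) := fun β => by cases β <;> assumption
  have hg : ∀ β, 2 ≤ g β := fun β => by cases β <;> assumption
  obtain ⟨R, I, hloc, hI0, hI⟩ := exists_stages g hg hbc
  choose y hy using fun m => exists_mem_stages (hI m) (by rw [hI0]; norm_num)
  refine ⟨y, ?_, fun m hm => ⟨?_, ?_⟩⟩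
  · rw [continuous_iff_continuousAt]
    intro m
    rw [ContinuousAt, Metric.tendsto_nhds]
    intro ε hε
    obtain ⟨i, hi⟩ := exists_pow_lt_of_lt_one hε (by norm_num : (1 / 2 : ℝ) < 1)
    have hnear : ∀ᶠ m' in 𝓝 m, ∀ j ∈ Finset.range (i + 1), m' j = m j := by
      rw [Filter.eventually_all_finset]
      intro j _
      exact (continuous_apply j).continuousAt.eventually (isOpen_discrete {m j} |>.mem_nhds rfl)
    filter_upwards [hnear] with m' hm'
    have h1 := hy m' (i + 1)
    rw [hloc m' m (i + 1) fun j hj => hm' j (Finset.mem_range.mpr hj)] at h1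
    have h2 := hy m (i + 1)
    have hle : ∀ k, 0 ≤ (I m k).1 ∧ (I m k).1 + (I m k).2 ≤ 1 := by
      intro k
      induction k with
      | zero => rw [hI0]; norm_num
      | succ k ih =>
        exact ⟨ih.1.trans (hI m k).lt_left.le, (hI m k).right_lt.le.trans ih.2⟩
    have h3 := (hI m i).snd_le hg (by linarith [(hle (i + 1)).1, (hle (i + 1)).2])
    rw [Real.dist_eq]
    refine lt_of_le_of_lt ?_ hi
    rw [abs_le]
    exact ⟨by linarith [h1.1, h2.2], by linarith [h1.2, h2.1]⟩
  · exact mem_normalNumbers_iff_of_stages hg (hI m) (hI0 m) hm (hy m) true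
  · exact mem_normalNumbers_iff_of_stages hg (hI m) (hI0 m) hm (hy m) false

lemma tendsto_atTop_iff_finite_bit (β : Bool) (z : ℕ → ℕ) (m : ℕ → ℕ)
    (hm : ∀ n, m (Nat.bit β n) = z n + 1) :
    Tendsto z atTop atTop ↔ ∀ M, {i | i.bodd = β ∧ m i ≤ M}.Finite := by
  have hset : ∀ M, {i | i.bodd = β ∧ m i ≤ M} = Nat.bit β '' {n | z n + 1 ≤ M} := by
    intro M
    ext i
    constructor
    · rintro ⟨rfl, hi⟩
      refine ⟨i.div2, ?_, Nat.bit_bodd_div2 i⟩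
      rw [mem_ofPred_eq, ← hm, Nat.bit_bodd_div2]; exact hi
    · rintro ⟨n, hn, rfl⟩
      exact ⟨Nat.bodd_bit β n, by rw [hm]; exact hn⟩
  have hinj : Function.Injective (Nat.bit β) := fun n n' h => by
    have := congrArg Nat.div2 h
    rwa [Nat.div2_bit, Nat.div2_bit] at this
  simp only [hset, finite_image_iff hinj.injOn]
  rw [tendsto_atTop]
  simp only [← Nat.cofinite_eq_atTop, eventually_cofinite, not_le, Nat.succ_le_iff]

theorem theorem2 (b c : ℕ) [NeZero b] [NeZero c] (hb : 2 ≤ b) (hc : 2 ≤ c)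
    (hbc : Nat.Coprime b c) :
    IsD2Pi0Complete.{u} 3 (normalNumbers b \ normalNumbers c) := by
  refine ⟨⟨_, _, isPi0_normalNumbers hb, isPi0_normalNumbers hc, rfl⟩, ?_⟩
  intro X _ _ _ B ⟨A, C, hA, hC, hB⟩
  obtain ⟨z, hz, hzA⟩ := hA.exists_continuous_tendsto_atTop
  obtain ⟨w, hw, hwC⟩ := hC.exists_continuous_tendsto_atTop
  obtain ⟨y, hy, hyiff⟩ := exists_continuous_mem_normalNumbers_iff hb hc hbc
  let m : X → ℕ → ℕ := fun x i => (bif i.bodd then z x i.div2 else w x i.div2) + 1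
  have hm : Continuous m := by
    refine continuous_pi fun i => ?_
    have h1 : Continuous fun x => bif i.bodd then z x i.div2 else w x i.div2 := by
      cases i.bodd
      · exact (continuous_apply _).comp hw
      · exact (continuous_apply _).comp hz
    exact continuous_of_discreteTopology.comp h1 (g := fun n : ℕ => n + 1)
  refine ⟨y ∘ m, hy.comp hm, ?_⟩
  ext x
  obtain ⟨h1, h2⟩ := hyiff (m x) fun i => Nat.succ_pos _
  rw [hB, Set.mem_sdiff, mem_preimage, Function.comp, Set.mem_sdiff, h1, h2, hzA, hwC,
    tendsto_atTop_iff_finite_bit true (z x) (m x) fun n => by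
      simp only [m, Nat.bodd_bit, Nat.div2_bit, cond_true],
    tendsto_atTop_iff_finite_bit false (w x) (m x) fun n => by
      simp only [m, Nat.bodd_bit, Nat.div2_bit, cond_false]]
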